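/- **Setting.** Let $n\ge 2$ and write $r=|x|$, $L^2_{t,x}=L^2(\mathbb R_+\times\mathbb R^n,\,dt\,dx)$. Fix a real function $\phi\in C_c^\infty(\mathbb R^n\setminus\{0\})$ with $\sum_{k\in\mathbb Z}\phi(2^{-k}\xi)=1$ for all $\xi\ne0$, and let $S_k$ be the Fourier multiplier in $x$ with symbol $\phi(2^{-k}\xi)$, acting at each time $t$ on tempered distributions in $x$. Put $A_j=\mathbb R_+\times\{2^{j-1}\le|x|\le 2^{j+1}\}$, $A_{\le m}=\bigcup_{j\le m}A_j$, and $$\|f\|_{X_k}=2^{k/2}\|f\|_{L^2_{t,x}(A_{\le -k})}+\sup_{j\ge -k}\big\||x|^{-1/2}f\big\|_{L^2_{t,x}(A_j)},\qquad \|u\|_{X^s}=\Big(\sum_{k\in\mathbb Z}2^{2ks}\|S_ku\|_{X_k}^2\Big)^{1/2},$$ for time-dependent tempered distributions $u=(u(t))_{t>0}$ on $\mathbb R^n$. The norm of a distribution that is not given by a measurable function of $(t,x)$ is $\infty$. Let $\nabla=\nabla_x$ be the distributional gradient in $x$, with $\|\nabla u\|_X=\sum_{i=1}^n\|\partial_{x_i}u\|_X$.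 Call $u$ *realized* if, for almost every $t>0$, $\sum_{|k|\le K}S_ku(t)\to u(t)$ in $\mathcal S'(\mathbb R^n)$ as $K\to\infty$ (this excludes nonzero polynomials in $x$). For a measurable function $g$ on $\mathbb R_+\times\mathbb R^n$, let $\|g\|_{(X^s)'}$ be the supremum of $\big|\iint g\,v\,dx\,dt\big|$ over all realized $v$ with $\|v\|_{X^s}\le1$; it is $\infty$ if for some such $v$ the distribution $v$ is not a function or $gv$ is not integrable. **Lemma.** For every $0<\delta<\frac{n-1}2$ there is a finite constant $C=C(n,\phi,\delta)$ such that every realized $u$ satisfies $$\|r^{-1/2-\delta}u\|_{L^2_{t,x}}\le C\|u\|_{X^\delta},\qquad \|r^{-1/2-\delta}u\|_{L^2_{t,x}}\le C\|\nabla u\|_{X^{\delta-1}};$$ in particular, $u$ is given by a function as soon as either right-hand side is finite. Moreover, for every measurable $g$ on $\mathbb R_+\times\mathbb R^n$, $$\|g\|_{(X^\delta)'}\le C\|r^{1/2+\delta}g\|_{L^2_{t,x}}.$$ Finally, there is a finite constant $C'=C'(n,\phi)$ such that for all $k\in\mathbb Z$ and all time-dependent tempered distributions $u$, $$\|S_ku\|_{X_k}\le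 C'\,2^{-k}\,\|\nabla S_ku\|_{X_k}.$$ -/

import Mathlib

open MeasureTheory Set Filter Topology
open scoped ENNReal NNReal SchwartzMap LineDeriv ContDiff

noncomputable section

namespace LocalizedEnergy

/-- Space `ℝⁿ` with its Euclidean norm. -/
abbrev Space (n : ℕ) := EuclideanSpace ℝ (Fin n)

/-- A time-dependent tempered distribution on `ℝⁿ`: only the times `t > 0` matter below. -/
abbrev TimeDist (n : ℕ) := ℝ → 𝓢'(Space n, ℂ)

/-- Lebesgue measure `dt dx` on `ℝ₊ × ℝⁿ`. -/
def spaceTime (n : ℕ) : Measure (ℝ × Space n) :=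
  (volume.restrict (Ioi (0 : ℝ))).prod volume

/-- The profile `φ` of a homogeneous Littlewood–Paley decomposition of `ℝⁿ`: smooth, with compact
support not containing the origin, and `∑ₖ φ(ξ / 2ᵏ) = 1` for every `ξ ≠ 0`. -/
structure IsLittlewoodPaley {n : ℕ} (φ : Space n → ℝ) : Prop where
  smooth : ContDiff ℝ ∞ φ
  compactSupport : HasCompactSupport φ
  zero_notMem : (0 : Space n) ∉ tsupport φ
  hasSum_one : ∀ ξ : Space n, ξ ≠ 0 → HasSum (fun k : ℤ => φ ((2 : ℝ) ^ (-k) • ξ)) 1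

/-- The Littlewood–Paley projection `S_k`, acting in the space variable at each time: the Fourier
multiplier with symbol `φ(ξ / 2ᵏ)`. -/
def LP {n : ℕ} (φ : Space n → ℝ) (k : ℤ) (u : TimeDist n) : TimeDist n := fun t =>
  TemperedDistribution.fourierMultiplierCLM ℂ
    (fun ξ : Space n => ((φ ((2 : ℝ) ^ (-k) • ξ) : ℝ) : ℂ)) (u t)

/-- The distributional partial derivative `∂u/∂xᵢ`. -/
def partialDeriv {n : ℕ} (i : Fin n) (u : TimeDist n) : TimeDist n := fun t =>
  ∂_{(EuclideanSpace.single i (1 : ℝ) : Space n)} (u t)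

/-- `u = ∑ₖ S_k u`: for almost every `t > 0` the Littlewood–Paley series of `u(t)` converges to
`u(t)` in the space of tempered distributions. This excludes nonzero polynomials in `x`, which are
annihilated by all `S_k`. -/
def IsSumOfLP {n : ℕ} (φ : Space n → ℝ) (u : TimeDist n) : Prop :=
  ∀ᵐ t ∂(volume.restrict (Ioi (0 : ℝ))),
    Tendsto (fun K : ℕ => ∑ k ∈ Finset.Icc (-(K : ℤ)) (K : ℤ), LP φ k u t) atTop (𝓝 (u t))

/-- The distribution `u` is given by the measurable function `f(t, x)` on `ℝ₊ × ℝⁿ`. Such an `f`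
is unique up to equality almost everywhere. -/
def IsGivenBy {n : ℕ} (u : TimeDist n) (f : ℝ × Space n → ℂ) : Prop :=
  AEStronglyMeasurable f (spaceTime n) ∧
  ∀ᵐ t ∂(volume.restrict (Ioi (0 : ℝ))), ∀ η : 𝓢(Space n, ℂ),
    Integrable (fun x => η x * f (t, x)) ∧ u t η = ∫ x, η x * f (t, x)

/-- The spatial dyadic shell `|x| ≈ 2ʲ`. -/
def shell (n : ℕ) (j : ℤ) : Set (Space n) :=
  {x | (2 : ℝ) ^ (j - 1) ≤ ‖x‖ ∧ ‖x‖ ≤ (2 : ℝ) ^ (j + 1)}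

/-- The region `A_j = ℝ₊ × {|x| ≈ 2ʲ}` (the condition `t > 0` is imposed by `spaceTime`). -/
def A (n : ℕ) (j : ℤ) : Set (ℝ × Space n) := {p | p.2 ∈ shell n j}

/-- `A_{≤ m}`, the union of the `A_j` with `j ≤ m`. -/
def ALe (n : ℕ) (m : ℤ) : Set (ℝ × Space n) := ⋃ j : ℤ, ⋃ _ : j ≤ m, A n j

/-- `‖ |x|ᵃ f ‖` in `L²_{t,x}` of the region `B`. -/
def weightedL2On {n : ℕ} (a : ℝ) (B : Set (ℝ × Space n)) (f : ℝ × Space n → ℂ) : ℝ≥0∞ :=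
  eLpNorm (fun p => (‖p.2‖ ^ a : ℝ) • f p) 2 ((spaceTime n).restrict B)

/-- `‖f‖_{X_k} = 2^{k/2} ‖f‖_{L²(A_{≤ -k})} + sup_{j ≥ -k} ‖ |x|^{-1/2} f ‖_{L²(A_j)}`
for a function `f(t, x)`. -/
def XkFun {n : ℕ} (k : ℤ) (f : ℝ × Space n → ℂ) : ℝ≥0∞ :=
  (2 : ℝ≥0∞) ^ ((k : ℝ) / 2) * eLpNorm f 2 ((spaceTime n).restrict (ALe n (-k))) +
    ⨆ j : ℤ, ⨆ _ : -k ≤ j, weightedL2On (-(1 / 2)) (A n j) f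

/-- `‖u‖_{X_k}` for a distribution: the norm of the function giving `u`, and `∞` if there is
none. -/
def Xk {n : ℕ} (k : ℤ) (u : TimeDist n) : ℝ≥0∞ :=
  ⨅ f : ℝ × Space n → ℂ, ⨅ _ : IsGivenBy u f, XkFun k f

/-- `‖ rᵃ u ‖_{L²_{t,x}}` for a distribution: the weighted norm of the function giving `u`, and `∞`
if there is none. -/
def weightedL2 {n : ℕ} (a : ℝ) (u : TimeDist n) : ℝ≥0∞ :=
  ⨅ f : ℝ × Space n → ℂ, ⨅ _ : IsGivenBy u f, weightedL2On a univ f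

/-- `‖u‖_{X^s} = (∑ₖ 2^{2ks} ‖S_k u‖²_{X_k})^{1/2}`. -/
def XNorm {n : ℕ} (φ : Space n → ℝ) (s : ℝ) (u : TimeDist n) : ℝ≥0∞ :=
  (∑' k : ℤ, (2 : ℝ≥0∞) ^ (2 * (k : ℝ) * s) * Xk k (LP φ k u) ^ 2) ^ (1 / 2 : ℝ)

/-- `‖∇u‖_{X_k}`, the sum of the norms of the components. -/
def XkGrad {n : ℕ} (k : ℤ) (u : TimeDist n) : ℝ≥0∞ := ∑ i : Fin n, Xk k (partialDeriv i u)

/-- `‖∇u‖_{X^s}`, the sum of the norms of the components. -/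
def XNormGrad {n : ℕ} (φ : Space n → ℝ) (s : ℝ) (u : TimeDist n) : ℝ≥0∞ :=
  ∑ i : Fin n, XNorm φ s (partialDeriv i u)

open Classical in
/-- `|∫∫ g f dx dt|`, with the value `∞` when `g f` is not integrable. -/
def absPairing {n : ℕ} (g f : ℝ × Space n → ℂ) : ℝ≥0∞ :=
  if Integrable (fun p => g p * f p) (spaceTime n) then ‖∫ p, g p * f p ∂(spaceTime n)‖ₑ else ⊤

/-- `‖g‖_{(X^s)'}`: the supremum of `|∫∫ g v dx dt|` over the unit ball of `X^s`, that is over all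
`v = ∑ₖ S_k v` with `‖v‖_{X^s} ≤ 1`. The inner infimum is over the functions `f` giving `v`; it is
`∞` if there is none, so that finiteness of the norm includes that all the pairings are defined. -/
def dualNorm {n : ℕ} (φ : Space n → ℝ) (s : ℝ) (g : ℝ × Space n → ℂ) : ℝ≥0∞ :=
  ⨆ v : TimeDist n, ⨆ _ : IsSumOfLP φ v ∧ XNorm φ s v ≤ 1,
    ⨅ f : ℝ × Space n → ℂ, ⨅ _ : IsGivenBy v f, absPairing g f

end LocalizedEnergy

end

open MeasureTheory Set Filter Topology
open scoped ENNReal NNReal SchwartzMap LineDeriv ContDiff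

noncomputable section

namespace LocalizedEnergy

/-! ### Tools from integration theory -/

/-! Put ρ = 2⁻ᵏ. Up to constants, ‖f‖²_{X_k} is the best B for which |f|² has mass at most R·B in
every cylinder |x| ≤ R with R ≥ ρ (`morreyBound_of_XkFun`, `XkFun_le_of_morreyBound`). Unlike the
shell norm, this Morrey condition is visibly stable under convolution in x with kernels at scale ρ
(`MorreyBound.conv`).

A frequency piece S_k u is reproduced by convolution with a Schwartz kernel at scale ρ.
`exists_kernelConv_bound` shows that this preserves the Morrey bound and also dominates |S_k u|² on
|x| ≤ ρ by a function N(t) whose time integral is at most a constant times ρ^(1-n) B. Against the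
weight |x|^(-1-2δ), the region |x| > ρ is then handled by dyadic summation, because δ > 0, and the
region |x| ≤ ρ by the pointwise bound, because 1 + 2δ < n. Both parts scale like ρ^(-2δ) = 2^(2kδ).

Both conditions on δ are strict, so there is room for an extra factor max(2ᵏ|x|, (2ᵏ|x|)⁻¹)^ε in the
single-frequency estimate (`exists_weighted_bound`). At fixed x its inverse is summable in k,
uniformly in x ≠ 0, and Cauchy–Schwarz in k turns ℓ² control of the pieces into control of their
absolute sum (`exists_lintegral_tsum_sq_le`). The same finiteness permits dominated convergence, so
the sum of the functions represents u when u is realized (`isGivenBy_tsum`).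

The gradient statements follow by writing S_k u as a sum of 2⁻ᵏ m_i(2⁻ᵏD) ∂_i S_k u with Schwartz
m_i (`exists_Xk_LP_le`). The dual bound is weighted Cauchy–Schwarz applied to the first estimate. -/

/-- The Cauchy–Schwarz inequality for lower Lebesgue integrals, in squared form. -/
theorem lintegral_mul_sq_le {α : Type*} [MeasurableSpace α] {μ : Measure α} {f g : α → ℝ≥0∞}
    (hf : AEMeasurable f μ) (hg : AEMeasurable g μ) :
    (∫⁻ a, f a * g a ∂μ) ^ 2 ≤ (∫⁻ a, f a ^ 2 ∂μ) * ∫⁻ a, g a ^ 2 ∂μ := by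
  have h := ENNReal.lintegral_mul_le_Lp_mul_Lq μ Real.HolderConjugate.two_two hf hg
  calc (∫⁻ a, f a * g a ∂μ) ^ 2
      ≤ ((∫⁻ a, f a ^ (2 : ℝ) ∂μ) ^ (1 / 2 : ℝ) * (∫⁻ a, g a ^ (2 : ℝ) ∂μ) ^ (1 / 2 : ℝ)) ^ 2 := by
        gcongr
        exact h
    _ = _ := by
        rw [mul_pow, ← ENNReal.rpow_natCast, ← ENNReal.rpow_natCast, ← ENNReal.rpow_mul,
          ← ENNReal.rpow_mul]
        norm_num

/-- The Cauchy–Schwarz inequality for series in `ℝ≥0∞`, in squared form. -/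
theorem tsum_mul_sq_le {ι : Type*} (f g : ι → ℝ≥0∞) :
    (∑' i, f i * g i) ^ 2 ≤ (∑' i, f i ^ 2) * ∑' i, g i ^ 2 := by
  let _ : MeasurableSpace ι := ⊤
  have : MeasurableSingletonClass ι := ⟨fun _ => trivial⟩
  have h := lintegral_mul_sq_le (μ := Measure.count) (f := f) (g := g)
    (measurable_from_top).aemeasurable (measurable_from_top).aemeasurable
  rwa [lintegral_count' measurable_from_top, lintegral_count' measurable_from_top,
    lintegral_count' measurable_from_top] at h

theorem eLpNorm_two_sq {α E : Type*} [MeasurableSpace α] [NormedAddCommGroup E] (μ : Measure α)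
    (f : α → E) : eLpNorm f 2 μ ^ 2 = ∫⁻ a, ‖f a‖ₑ ^ 2 ∂μ := by
  have := eLpNorm_nnreal_pow_eq_lintegral (f := f) (μ := μ) (p := 2) (by norm_num)
  simpa using this

theorem lintegral_comp_smul {n : ℕ} (f : Space n → ℝ≥0∞) {c : ℝ} (hc : 0 < c) :
    ∫⁻ x, f (c • x) = ENNReal.ofReal (c ^ n)⁻¹ * ∫⁻ x, f x := by
  have h := lintegral_map_equiv (μ := (volume : Measure (Space n))) f
    (Homeomorph.smulOfNeZero c hc.ne').toMeasurableEquiv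
  have h2 : Measure.map (Homeomorph.smulOfNeZero c hc.ne').toMeasurableEquiv
      (volume : Measure (Space n)) = ENNReal.ofReal (c ^ n)⁻¹ • volume := by
    have := Measure.map_addHaar_smul (volume : Measure (Space n)) hc.ne'
    rw [finrank_euclideanSpace_fin, abs_of_nonneg (by positivity)] at this
    exact this
  rw [h2, lintegral_smul_measure] at h
  exact h.symm

/-- A power of the norm below the critical one is integrable near the origin. -/
theorem lintegral_ball_norm_rpow_lt_top {n : ℕ} (hn : 1 ≤ n) {a : ℝ} (ha : a < n) :
    ∫⁻ x in {x : Space n | ‖x‖ ≤ 1}, ENNReal.ofReal (‖x‖ ^ (-a)) < ⊤ := by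
  have h := integrableOn_ball_of_norm_le_rpow (μ := (volume : Measure (Space n))) (r := 2)
    (f := fun x => ‖x‖ ^ (-a)) (C := 1) (α := a) (by simpa using hn) (by simpa using ha)
    (ae_of_all _ fun x => by
      rw [one_mul, Real.norm_of_nonneg (Real.rpow_nonneg (norm_nonneg _) _)])
    (Measurable.aestronglyMeasurable (by fun_prop))
  have h2 := h.lintegral_lt_top
  refine lt_of_le_of_lt (lintegral_mono_set fun x hx => ?_) h2
  simp only [mem_ofPred_eq] at hx
  simp only [Metric.mem_ball, dist_zero_right]
  linarith

/-- The weighted `L²` norms of a Schwartz function are finite. -/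
theorem schwartz_lintegral_weight_lt_top {n : ℕ} (η : 𝓢(Space n, ℂ)) (N : ℕ) :
    ∫⁻ x, ENNReal.ofReal ((1 + ‖x‖) ^ N) * ‖η x‖ₑ ^ 2 < ⊤ := by
  have h1 : Integrable (fun x : Space n => (1 + ‖x‖) ^ N * ‖η x‖) := by
    have : (fun x : Space n => (1 + ‖x‖) ^ N * ‖η x‖) = fun x =>
        ∑ m ∈ Finset.range (N + 1), (N.choose m : ℝ) * (‖x‖ ^ (N - m) * ‖η x‖) := by
      ext x
      rw [add_pow, Finset.sum_mul]
      refine Finset.sum_congr rfl fun m _ => ?_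
      ring
    rw [this]
    exact integrable_finsetSum _ fun m _ => (η.integrable_pow_mul volume _).const_mul _
  -- One factor |η| is bounded by its supremum, so the square needs only weighted L¹ decay.
  have h2 : Integrable (fun x : Space n => SchwartzMap.seminorm ℝ 0 0 η *
      ((1 + ‖x‖) ^ N * ‖η x‖)) := h1.const_mul _
  refine lt_of_le_of_lt (lintegral_mono fun x => ?_) h2.lintegral_lt_top
  rw [← ofReal_norm, ← ENNReal.ofReal_pow (norm_nonneg _),
    ← ENNReal.ofReal_mul (by positivity)]
  refine ENNReal.ofReal_le_ofReal ?_
  have := SchwartzMap.norm_le_seminorm ℝ η x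
  calc (1 + ‖x‖) ^ N * ‖η x‖ ^ 2 = ‖η x‖ * ((1 + ‖x‖) ^ N * ‖η x‖) := by ring
    _ ≤ _ := by gcongr

section

variable {n : ℕ}

/-! ### Morrey bounds -/

/-- The density `F` has mass at most `R B` in `{|x| ≤ R}`, for all radii `R ≥ ρ`. For `F = |f|²` and
`ρ = 2⁻ᵏ`, the best constant `B` is equivalent to `‖f‖²_{X_k}`. -/
def MorreyBound {n : ℕ} (ρ : ℝ) (F : ℝ × Space n → ℝ≥0∞) (B : ℝ≥0∞) : Prop :=
  ∀ R : ℝ, ρ ≤ R → ∫⁻ p in {p : ℝ × Space n | ‖p.2‖ ≤ R}, F p ∂spaceTime n ≤ ENNReal.ofReal R * B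

theorem measurableSet_cylinder (R : ℝ) : MeasurableSet {p : ℝ × Space n | ‖p.2‖ ≤ R} :=
  measurableSet_le (by fun_prop) (by fun_prop)

theorem MorreyBound.mono {ρ : ℝ} {F G : ℝ × Space n → ℝ≥0∞} {B D : ℝ≥0∞}
    (h : MorreyBound ρ F B) (hG : ∀ᵐ p ∂spaceTime n, G p ≤ F p) (hB : B ≤ D) :
    MorreyBound ρ G D := fun R hR =>
  (lintegral_mono_ae (ae_restrict_of_ae hG)).trans ((h R hR).trans (by gcongr))

theorem MorreyBound.const_mul {ρ : ℝ} {F : ℝ × Space n → ℝ≥0∞} {B : ℝ≥0∞}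
    (h : MorreyBound ρ F B) {c : ℝ≥0∞} (hc : c ≠ ⊤) :
    MorreyBound ρ (fun p => c * F p) (c * B) := fun R hR => by
  rw [lintegral_const_mul' _ _ hc]
  calc _ ≤ c * (ENNReal.ofReal R * B) := by gcongr; exact h R hR
    _ = _ := by ring

theorem MorreyBound.finset_sum {ι : Type*} {s : Finset ι} {ρ : ℝ} {F : ι → ℝ × Space n → ℝ≥0∞}
    {B : ι → ℝ≥0∞} (hF : ∀ i ∈ s, AEMeasurable (F i) (spaceTime n))
    (h : ∀ i ∈ s, MorreyBound ρ (F i) (B i)) :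
    MorreyBound ρ (fun p => ∑ i ∈ s, F i p) (∑ i ∈ s, B i) := fun R hR => by
  rw [lintegral_finsetSum' _ fun i hi => (hF i hi).restrict, Finset.mul_sum]
  exact Finset.sum_le_sum fun i hi => h i hi R hR

theorem measurableSet_A (j : ℤ) : MeasurableSet (A n j) := by
  have : A n j = {p : ℝ × Space n | (2 : ℝ) ^ (j - 1) ≤ ‖p.2‖} ∩
      {p | ‖p.2‖ ≤ (2 : ℝ) ^ (j + 1)} := rfl
  rw [this]
  exact (measurableSet_le (by fun_prop) (by fun_prop)).inter (measurableSet_cylinder _)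

theorem weightedL2On_sq (a : ℝ) (B : Set (ℝ × Space n)) (f : ℝ × Space n → ℂ) :
    weightedL2On a B f ^ 2 =
      ∫⁻ p in B, ENNReal.ofReal (‖p.2‖ ^ (2 * a)) * ‖f p‖ₑ ^ 2 ∂spaceTime n := by
  rw [weightedL2On, eLpNorm_two_sq]
  refine lintegral_congr fun p => ?_
  rw [enorm_smul, mul_pow, Real.enorm_of_nonneg (by positivity), ← ENNReal.ofReal_pow (by positivity),
    ← Real.rpow_mul_natCast (norm_nonneg _)]
  congr 3
  push_cast
  ring

theorem two_zpow_le_iff {x : ℝ} (hx : 0 < x) (j : ℤ) : (2 : ℝ) ^ j ≤ x ↔ j ≤ Int.log 2 x := by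
  have := Int.zpow_le_iff_le_log (R := ℝ) (b := 2) (by norm_num) (x := j) hx
  simpa using this

theorem lt_two_zpow_log_add_one {x : ℝ} : x < (2 : ℝ) ^ (Int.log 2 x + 1) := by
  simpa using Int.lt_zpow_succ_log_self (R := ℝ) (b := 2) (by norm_num) x

theorem ae_ne_zero (hn : 1 ≤ n) : ∀ᵐ x : Space n, x ≠ 0 := by
  have : Nontrivial (Space n) := Module.nontrivial_of_finrank_pos (R := ℝ) (by simpa using Nat.pos_of_ne_zero (by omega))
  have h := measure_singleton (μ := (volume : Measure (Space n))) 0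
  exact compl_mem_ae_iff.2 h

theorem ae_spaceTime_snd {P : Space n → Prop} (h : ∀ᵐ x, P x) :
    ∀ᵐ p ∂spaceTime n, P p.2 :=
  (Measure.quasiMeasurePreserving_snd (μ := volume.restrict (Ioi (0 : ℝ)))).ae h

/-- The punctured ball of radius `2^(1-k)` is covered by the shells defining `A_{≤ -k}`. -/
theorem cylinder_ae_subset_ALe (hn : 1 ≤ n) (m : ℤ) :
    {p : ℝ × Space n | ‖p.2‖ ≤ (2 : ℝ) ^ (m + 1)} ≤ᵐ[spaceTime n] ALe n m := by
  filter_upwards [ae_spaceTime_snd (ae_ne_zero hn)] with p hp hpm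
  have h0 : 0 < ‖p.2‖ := norm_pos_iff.2 hp
  simp only [ALe]
  change p ∈ {p : ℝ × Space n | ‖p.2‖ ≤ (2 : ℝ) ^ (m + 1)} at hpm
  have hpm' : ‖p.2‖ ≤ (2 : ℝ) ^ (m + 1) := hpm
  -- The minimum matters only on the sphere ‖x‖ = 2^(m+1): the logarithm there is m + 1, but shell m
  -- still contains the point.
  refine mem_iUnion.2 ⟨min m (Int.log 2 ‖p.2‖), mem_iUnion.2 ⟨min_le_left _ _, ?_⟩⟩
  refine ⟨?_, ?_⟩
  · rw [two_zpow_le_iff h0]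
    omega
  · rcases min_choice m (Int.log 2 ‖p.2‖) with h | h
    · rwa [h]
    · rw [h]
      exact lt_two_zpow_log_add_one.le

theorem ALe_subset_cylinder (m : ℤ) :
    ALe n m ⊆ {p : ℝ × Space n | ‖p.2‖ ≤ (2 : ℝ) ^ (m + 1)} := by
  intro p hp
  simp only [ALe, mem_iUnion] at hp
  obtain ⟨j, hj, hpj⟩ := hp
  exact hpj.2.trans (zpow_le_zpow_right₀ (by norm_num) (by omega))

theorem ofReal_two_zpow (j : ℤ) : ENNReal.ofReal ((2 : ℝ) ^ j) = (2 : ℝ≥0∞) ^ (j : ℝ) := by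
  rw [← Real.rpow_intCast, ← ENNReal.ofReal_rpow_of_pos (by norm_num)]
  norm_num

/-- Shell masses grow at most like 2^j, so the mass of a large ball is a geometric sum dominated by
its outermost shell. -/
theorem morreyBound_of_XkFun (hn : 1 ≤ n) (k : ℤ) (f : ℝ × Space n → ℂ) :
    MorreyBound ((2 : ℝ) ^ (-k)) (fun p => ‖f p‖ₑ ^ 2) (8 * XkFun k f ^ 2) := by
  set X := XkFun k f with hX
  have hin : ∫⁻ p in {p : ℝ × Space n | ‖p.2‖ ≤ (2 : ℝ) ^ (-k + 1)}, ‖f p‖ₑ ^ 2 ∂spaceTime n ≤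
      ENNReal.ofReal ((2 : ℝ) ^ (-k)) * X ^ 2 := by
    calc _ ≤ ∫⁻ p in ALe n (-k), ‖f p‖ₑ ^ 2 ∂spaceTime n :=
          lintegral_mono' (Measure.restrict_mono' (cylinder_ae_subset_ALe hn _) le_rfl) le_rfl
      _ = ENNReal.ofReal ((2 : ℝ) ^ (-k)) *
          ((2 : ℝ≥0∞) ^ ((k : ℝ) / 2) * eLpNorm f 2 ((spaceTime n).restrict (ALe n (-k)))) ^ 2 := by
        rw [mul_pow, eLpNorm_two_sq, ← mul_assoc, ofReal_two_zpow, ← ENNReal.rpow_natCast,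
          ← ENNReal.rpow_mul, ← ENNReal.rpow_add _ _ (by norm_num) (by norm_num)]
        have : ((-k : ℤ) : ℝ) + (k : ℝ) / 2 * (2 : ℕ) = 0 := by push_cast; ring
        rw [this, ENNReal.rpow_zero, one_mul]
      _ ≤ _ := by
        gcongr
        exact le_self_add
  have hsh : ∀ j : ℤ, -k ≤ j → ∫⁻ p in A n j, ‖f p‖ₑ ^ 2 ∂spaceTime n ≤
      ENNReal.ofReal ((2 : ℝ) ^ (j + 1)) * X ^ 2 := by
    intro j hj
    calc _ ≤ ∫⁻ p in A n j, ENNReal.ofReal ((2 : ℝ) ^ (j + 1)) *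
          (ENNReal.ofReal (‖p.2‖ ^ (2 * (-(1 / 2) : ℝ))) * ‖f p‖ₑ ^ 2) ∂spaceTime n := by
          refine setLIntegral_mono' (measurableSet_A j) fun p hp => ?_
          have h0 : 0 < ‖p.2‖ := lt_of_lt_of_le (by positivity) hp.1
          rw [← mul_assoc, ← ENNReal.ofReal_mul (by positivity)]
          refine le_mul_of_one_le_left (zero_le) ?_
          rw [ENNReal.one_le_ofReal]
          have : (2 * (-(1 / 2) : ℝ)) = -1 := by norm_num
          rw [this, Real.rpow_neg_one, ← div_eq_mul_inv, one_le_div h0]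
          exact hp.2
      _ = ENNReal.ofReal ((2 : ℝ) ^ (j + 1)) * weightedL2On (-(1 / 2)) (A n j) f ^ 2 := by
          rw [lintegral_const_mul' _ _ ENNReal.ofReal_ne_top, weightedL2On_sq]
      _ ≤ _ := by
        gcongr
        exact (le_iSup₂ (f := fun (j : ℤ) (_ : -k ≤ j) => weightedL2On (-(1 / 2)) (A n j) f)
          j hj).trans le_add_self
  -- Each new shell contributes at most 2^(-k+l+2) X², exactly the bound already reached, so the
  -- bound doubles along with the radius.
  have hball : ∀ l : ℕ, ∫⁻ p in {p : ℝ × Space n | ‖p.2‖ ≤ (2 : ℝ) ^ (-k + 1 + l)},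
      ‖f p‖ₑ ^ 2 ∂spaceTime n ≤ ENNReal.ofReal ((2 : ℝ) ^ (-k + 2 + l)) * X ^ 2 := by
    intro l
    induction l with
    | zero =>
      simp only [Nat.cast_zero, add_zero]
      refine hin.trans ?_
      gcongr
      · norm_num
      · omega
    | succ l ih =>
      calc _ ≤ ∫⁻ p in {p : ℝ × Space n | ‖p.2‖ ≤ (2 : ℝ) ^ (-k + 1 + l)} ∪ A n (-k + l + 1),
            ‖f p‖ₑ ^ 2 ∂spaceTime n := by
            refine lintegral_mono_set fun p hp => ?_
            by_cases h : ‖p.2‖ ≤ (2 : ℝ) ^ (-k + 1 + l)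
            · exact Or.inl h
            · refine Or.inr ⟨le_trans ?_ (not_le.1 h).le, le_trans hp ?_⟩
              · exact zpow_le_zpow_right₀ (by norm_num) (by omega)
              · exact zpow_le_zpow_right₀ (by norm_num) (by push_cast; omega)
        _ ≤ _ := lintegral_union_le _ _ _
        _ ≤ ENNReal.ofReal ((2 : ℝ) ^ (-k + 2 + l)) * X ^ 2 +
            ENNReal.ofReal ((2 : ℝ) ^ (-k + l + 1 + 1)) * X ^ 2 :=
            add_le_add ih (hsh _ (by omega))
        _ = _ := by
          rw [← add_mul, ← ENNReal.ofReal_add (by positivity) (by positivity)]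
          congr 2
          have h1 : (-k + l + 1 + 1 : ℤ) = -k + 2 + l := by ring
          have h2 : (-k + 2 + ((l + 1 : ℕ) : ℤ)) = -k + 2 + l + 1 := by push_cast; ring
          rw [h1, h2, zpow_add_one₀ (by norm_num)]
          ring
  intro R hR
  have hR0 : 0 < R := lt_of_lt_of_le (by positivity) hR
  rw [two_zpow_le_iff hR0] at hR
  obtain ⟨l, hl⟩ := Int.eq_ofNat_of_zero_le (sub_nonneg.2 hR)
  have hl' : Int.log 2 R = -k + l := by omega
  calc _ ≤ ∫⁻ p in {p : ℝ × Space n | ‖p.2‖ ≤ (2 : ℝ) ^ (-k + 1 + l)}, ‖f p‖ₑ ^ 2 ∂spaceTime n := by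
        refine lintegral_mono_set fun p (hp : ‖p.2‖ ≤ R) => show ‖p.2‖ ≤ _ from hp.trans ?_
        have := (lt_two_zpow_log_add_one (x := R)).le
        rwa [hl', show (-k + l + 1 : ℤ) = -k + 1 + l by ring] at this
    _ ≤ _ := hball l
    _ ≤ ENNReal.ofReal (R * 8) * X ^ 2 := by
        gcongr
        have : (2 : ℝ) ^ (-k + l) ≤ R := by rw [two_zpow_le_iff hR0, hl']
        rw [show (-k + 2 + l : ℤ) = -k + l + 2 by ring, zpow_add₀ (by norm_num)]
        norm_num
        linarith
    _ = _ := by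
        rw [ENNReal.ofReal_mul hR0.le, mul_assoc]
        norm_num

/-- On shell j the weight |x|⁻¹ is at most 2^(1-j) and the shell lies in the ball of radius 2^(j+1),
so a single radius controls each term of the norm. -/
theorem XkFun_le_of_morreyBound (k : ℤ) (f : ℝ × Space n → ℂ) {B : ℝ≥0∞}
    (h : MorreyBound ((2 : ℝ) ^ (-k)) (fun p => ‖f p‖ₑ ^ 2) (B ^ 2)) : XkFun k f ≤ 4 * B := by
  have key : ∀ {a : ℝ≥0∞}, a ^ 2 ≤ (2 * B) ^ 2 → a ≤ 2 * B := fun h =>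
    (ENNReal.pow_le_pow_left_iff two_ne_zero).1 h
  have h1 : (2 : ℝ≥0∞) ^ ((k : ℝ) / 2) * eLpNorm f 2 ((spaceTime n).restrict (ALe n (-k))) ≤
      2 * B := by
    apply key
    rw [mul_pow, eLpNorm_two_sq]
    calc _ ≤ ((2 : ℝ≥0∞) ^ ((k : ℝ) / 2)) ^ 2 * (ENNReal.ofReal ((2 : ℝ) ^ (-k + 1)) * B ^ 2) := by
          gcongr
          exact (lintegral_mono_set (ALe_subset_cylinder _)).trans
            (h _ (zpow_le_zpow_right₀ (by norm_num) (by omega)))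
      _ = 2 * B ^ 2 := by
        rw [ofReal_two_zpow, ← ENNReal.rpow_natCast, ← ENNReal.rpow_mul, ← mul_assoc,
          ← ENNReal.rpow_add _ _ (by norm_num) (by norm_num)]
        have : (k : ℝ) / 2 * (2 : ℕ) + ((-k + 1 : ℤ) : ℝ) = 1 := by push_cast; ring
        rw [this, ENNReal.rpow_one]
      _ ≤ (2 * B) ^ 2 := by
        rw [mul_pow]
        gcongr
        norm_num
  have h2 : ∀ j : ℤ, -k ≤ j → weightedL2On (-(1 / 2)) (A n j) f ≤ 2 * B := by
    intro j hj
    apply key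
    rw [weightedL2On_sq]
    calc _ ≤ ∫⁻ p in A n j, ENNReal.ofReal ((2 : ℝ) ^ (-j + 1)) * ‖f p‖ₑ ^ 2 ∂spaceTime n := by
          refine setLIntegral_mono' (measurableSet_A j) fun p hp => ?_
          gcongr
          have : (2 * (-(1 / 2) : ℝ)) = -1 := by norm_num
          rw [this, Real.rpow_neg_one, show (-j + 1 : ℤ) = -(j - 1) by ring, zpow_neg]
          exact inv_anti₀ (by positivity) hp.1
      _ ≤ ENNReal.ofReal ((2 : ℝ) ^ (-j + 1)) * (ENNReal.ofReal ((2 : ℝ) ^ (j + 1)) * B ^ 2) := by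
          rw [lintegral_const_mul' _ _ ENNReal.ofReal_ne_top]
          gcongr
          exact (lintegral_mono_set fun p hp => hp.2).trans
            (h _ (zpow_le_zpow_right₀ (by norm_num) (by omega)))
      _ = (2 * B) ^ 2 := by
        rw [← mul_assoc, ← ENNReal.ofReal_mul (by positivity), ← zpow_add₀ (by norm_num),
          show (-j + 1 + (j + 1) : ℤ) = 2 by ring, mul_pow]
        norm_num
  calc XkFun k f ≤ 2 * B + 2 * B := add_le_add h1 (iSup₂_le h2)
    _ = _ := by ring

/-- A density with a Morrey bound is integrable against weights decaying faster than `|x|⁻¹`. -/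
theorem MorreyBound.lintegral_weight_le {a : ℝ} (ha : 0 < a) :
    ∃ C : ℝ≥0, ∀ {n : ℕ} {ρ : ℝ} {F : ℝ × Space n → ℝ≥0∞} {B : ℝ≥0∞}, 0 < ρ →
      AEMeasurable F (spaceTime n) → MorreyBound ρ F B →
      ∫⁻ p, ENNReal.ofReal (max 1 (‖p.2‖ / ρ) ^ (-(1 + a))) * F p ∂spaceTime n ≤
        C * ENNReal.ofReal ρ * B := by
  have hq0 : (0 : ℝ) ≤ (2 : ℝ) ^ (-a) := by positivity
  have hq1 : (2 : ℝ) ^ (-a) < 1 := Real.rpow_lt_one_of_one_lt_of_neg (by norm_num) (by linarith)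
  have hsum : Summable fun l : ℕ => ((2 : ℝ) ^ (-a)) ^ l := summable_geometric_of_lt_one hq0 hq1
  refine ⟨(2 * ∑' l : ℕ, ((2 : ℝ) ^ (-a)) ^ l).toNNReal, fun {n ρ F B} hρ hF h => ?_⟩
  have hpt : ∀ p : ℝ × Space n, ENNReal.ofReal (max 1 (‖p.2‖ / ρ) ^ (-(1 + a))) * F p ≤
      ∑' l : ℕ, ENNReal.ofReal (((2 : ℝ) ^ l) ^ (-(1 + a))) *
        {p : ℝ × Space n | ‖p.2‖ ≤ 2 ^ (l + 1) * ρ}.indicator F p := by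
    intro p
    -- The weight on the l-th annulus is at most 2^(-l(1+a)) and the mass at most 2^(l+1) ρB; the
    -- product is geometric in l with ratio 2^(-a).
    obtain ⟨l, hl1, hl2⟩ := exists_nat_pow_near (le_max_left 1 (‖p.2‖ / ρ)) (one_lt_two)
    refine le_trans ?_ (ENNReal.le_tsum l)
    rw [indicator_of_mem]
    · gcongr ENNReal.ofReal ?_ * _
      exact Real.rpow_le_rpow_of_nonpos (by positivity) hl1 (by linarith)
    · have := ((le_max_right 1 (‖p.2‖ / ρ)).trans_lt hl2).le
      rwa [div_le_iff₀ hρ] at this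
  have hm : ∀ R : ℝ, AEMeasurable ({p : ℝ × Space n | ‖p.2‖ ≤ R}.indicator F) (spaceTime n) :=
    fun R => hF.indicator (measurableSet_cylinder R)
  calc _ ≤ ∫⁻ p, ∑' l : ℕ, ENNReal.ofReal (((2 : ℝ) ^ l) ^ (-(1 + a))) *
        {p : ℝ × Space n | ‖p.2‖ ≤ 2 ^ (l + 1) * ρ}.indicator F p ∂spaceTime n :=
        lintegral_mono hpt
    _ = ∑' l : ℕ, ENNReal.ofReal (((2 : ℝ) ^ l) ^ (-(1 + a))) *
        ∫⁻ p in {p : ℝ × Space n | ‖p.2‖ ≤ 2 ^ (l + 1) * ρ}, F p ∂spaceTime n := by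
      rw [lintegral_tsum fun l => (hm _).const_mul _]
      congr 1 with l
      rw [lintegral_const_mul' _ _ ENNReal.ofReal_ne_top,
        lintegral_indicator (measurableSet_cylinder _)]
    _ ≤ ∑' l : ℕ, ENNReal.ofReal (2 * ((2 : ℝ) ^ (-a)) ^ l) * (ENNReal.ofReal ρ * B) := by
      refine ENNReal.tsum_le_tsum fun l => ?_
      calc _ ≤ ENNReal.ofReal (((2 : ℝ) ^ l) ^ (-(1 + a))) *
            (ENNReal.ofReal (2 ^ (l + 1) * ρ) * B) := by
            gcongr
            refine h _ ?_
            exact le_mul_of_one_le_left hρ.le (one_le_pow₀ (by norm_num))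
        _ = _ := by
          rw [ENNReal.ofReal_mul (by positivity), ← mul_assoc, ← mul_assoc, ← mul_assoc,
            ← ENNReal.ofReal_mul (by positivity)]
          congr 3
          have : (((2 : ℝ) ^ l) ^ (-(1 + a))) = ((2 : ℝ) ^ (-a)) ^ l * (2 ^ l)⁻¹ := by
            rw [← Real.rpow_natCast, ← Real.rpow_natCast, ← Real.rpow_mul (by norm_num),
              ← Real.rpow_mul (by norm_num), ← Real.rpow_neg (by norm_num),
              ← Real.rpow_add (by norm_num)]
            congr 1
            ring
          rw [this, pow_succ]
          field_simp
    _ = _ := by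
      rw [ENNReal.tsum_mul_right, ← ENNReal.ofReal_tsum_of_nonneg (fun l => by positivity)
        (hsum.mul_left 2), tsum_mul_left, ← mul_assoc]
      rfl

theorem measurePreserving_spaceTime_sub (z : Space n) :
    MeasurePreserving (fun p : ℝ × Space n => (p.1, p.2 - z)) (spaceTime n) (spaceTime n) :=
  (MeasurePreserving.id (volume.restrict (Ioi (0 : ℝ)))).prod
    (measurePreserving_sub_right (volume : Measure (Space n)) z)

instance : SFinite (spaceTime n) := by unfold spaceTime; infer_instance

/-- Convolution in space with an integrable kernel preserves Morrey bounds. -/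
theorem MorreyBound.conv {ρ : ℝ} {F : ℝ × Space n → ℝ≥0∞} {B : ℝ≥0∞} {G : Space n → ℝ≥0∞}
    (hρ : 0 < ρ) (hF : Measurable F) (hG : Measurable G) (h : MorreyBound ρ F B) :
    MorreyBound ρ (fun p => ∫⁻ z, G z * F (p.1, p.2 - z))
      ((∫⁻ z, G z * ENNReal.ofReal (1 + ‖z‖ / ρ)) * B) := by
  intro R hR
  have hR0 : 0 < R := hρ.trans_le hR
  rw [lintegral_lintegral_swap (by
    refine Measurable.aemeasurable ?_
    fun_prop)]
  calc _ ≤ ∫⁻ z, (G z * ENNReal.ofReal (1 + ‖z‖ / ρ)) * (ENNReal.ofReal R * B) := by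
        refine lintegral_mono fun z => ?_
        rw [lintegral_const_mul _ (by fun_prop)]
        rw [mul_assoc]
        gcongr
        -- Translating by z enlarges the ball to radius R + ‖z‖, which is at most (1 + ‖z‖/ρ) R
        -- because R ≥ ρ.
        calc ∫⁻ p in {p : ℝ × Space n | ‖p.2‖ ≤ R}, F (p.1, p.2 - z) ∂spaceTime n
            ≤ ∫⁻ p in (fun p : ℝ × Space n => (p.1, p.2 - z)) ⁻¹'
                {p : ℝ × Space n | ‖p.2‖ ≤ R + ‖z‖}, F (p.1, p.2 - z) ∂spaceTime n := by
              refine lintegral_mono_set fun p (hp : ‖p.2‖ ≤ R) => ?_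
              exact (norm_sub_le _ _).trans (by gcongr)
          _ = ∫⁻ p in {p : ℝ × Space n | ‖p.2‖ ≤ R + ‖z‖}, F p ∂spaceTime n :=
              (measurePreserving_spaceTime_sub z).setLIntegral_comp_preimage
                (measurableSet_cylinder _) hF
          _ ≤ ENNReal.ofReal (R + ‖z‖) * B := h _ (by linarith [norm_nonneg z])
          _ ≤ ENNReal.ofReal (1 + ‖z‖ / ρ) * (ENNReal.ofReal R * B) := by
              rw [← mul_assoc, ← ENNReal.ofReal_mul (by positivity)]
              gcongr
              have : ‖z‖ / ρ * ρ ≤ ‖z‖ / ρ * R := by gcongr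
              rw [div_mul_cancel₀ _ hρ.ne'] at this
              linarith
    _ = _ := by
      rw [lintegral_mul_const _ (by fun_prop)]
      ring

/-! ### Convolution kernels of dilated Fourier multipliers -/

open FourierTransform in
/-- The convolution kernel of the Fourier multiplier with symbol `ξ ↦ m (ρ ξ)`. -/
def dilatedKernel (m : 𝓢(Space n, ℂ)) (ρ : ℝ) (z : Space n) : ℂ :=
  ((ρ ^ n)⁻¹ : ℝ) • (𝓕⁻ m : 𝓢(Space n, ℂ)) (ρ⁻¹ • z)

theorem continuous_dilatedKernel (m : 𝓢(Space n, ℂ)) (ρ : ℝ) : Continuous (dilatedKernel m ρ) := by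
  unfold dilatedKernel
  fun_prop

-- A multiplier acts on a distribution by transposition, replacing η by 𝓕(m 𝓕⁻η). Writing the
-- transposed operator as a kernel integral lets Fubini move it onto the function.
open FourierTransform in
theorem fourier_smulLeft_fourierInv_apply (m η : 𝓢(Space n, ℂ)) (y : Space n) :
    (𝓕 (SchwartzMap.smulLeftCLM ℂ m (𝓕⁻ η)) : 𝓢(Space n, ℂ)) y =
      ∫ x, (𝓕⁻ m : 𝓢(Space n, ℂ)) (x - y) * η x := by
  -- Reflecting η turns the correlation with the kernel into a convolution, to which the Fourier
  -- product formula applies.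
  set ηn : 𝓢(Space n, ℂ) :=
    SchwartzMap.compCLMOfContinuousLinearEquiv ℂ (ContinuousLinearEquiv.neg ℝ) η with hηn
  have hηn_apply : ∀ x, ηn x = η (-x) := fun x => rfl
  have h1 : (𝓕 ηn : 𝓢(Space n, ℂ)) = 𝓕⁻ η := by
    ext ξ
    rw [SchwartzMap.fourier_coe, SchwartzMap.fourierInv_coe, Real.fourierInv_eq_fourier_comp_neg]
    rfl
  set P : 𝓢(Space n, ℂ) := SchwartzMap.smulLeftCLM ℂ m (𝓕⁻ η) with hP
  have h2 : (𝓕⁻ P : 𝓢(Space n, ℂ)) =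
      SchwartzMap.convolution (ContinuousLinearMap.mul ℂ ℂ) (𝓕⁻ m) ηn := by
    have h3 : SchwartzMap.pairing (ContinuousLinearMap.mul ℂ ℂ) m (𝓕⁻ η) = P := by
      ext ξ
      rw [hP, SchwartzMap.smulLeftCLM_apply_apply m.hasTemperateGrowth]
      simp
    rw [← h3, ← h1]
    have := SchwartzMap.fourier_convolution (ContinuousLinearMap.mul ℂ ℂ) (𝓕⁻ m) ηn
    rw [FourierTransform.fourier_fourierInv_eq] at this
    rw [← this, FourierTransform.fourierInv_fourier_eq]
  have h4 : (𝓕 P : 𝓢(Space n, ℂ)) y = (𝓕⁻ P : 𝓢(Space n, ℂ)) (-y) := by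
    rw [SchwartzMap.fourier_coe, SchwartzMap.fourierInv_coe, Real.fourierInv_eq_fourier_neg, neg_neg]
  rw [h4, h2, SchwartzMap.convolution_apply, MeasureTheory.convolution_def,
    ← integral_sub_right_eq_self _ y]
  refine integral_congr_ae (ae_of_all _ fun x => ?_)
  simp [hηn_apply]

/-- The dilation `ξ ↦ m (ρ ξ)` of a Schwartz function. -/
def dilate (m : 𝓢(Space n, ℂ)) {ρ : ℝ} (hρ : 0 < ρ) : 𝓢(Space n, ℂ) :=
  SchwartzMap.compCLMOfContinuousLinearEquiv ℂ
    (ContinuousLinearEquiv.smulLeft (Units.mk0 ρ hρ.ne')) m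

theorem dilate_apply (m : 𝓢(Space n, ℂ)) {ρ : ℝ} (hρ : 0 < ρ) (ξ : Space n) :
    dilate m hρ ξ = m (ρ • ξ) := rfl

open FourierTransform in
theorem fourierInv_dilate (m : 𝓢(Space n, ℂ)) {ρ : ℝ} (hρ : 0 < ρ) (z : Space n) :
    (𝓕⁻ (dilate m hρ) : 𝓢(Space n, ℂ)) z = dilatedKernel m ρ z := by
  rw [dilatedKernel, SchwartzMap.fourierInv_coe, SchwartzMap.fourierInv_coe, Real.fourierInv_eq',
    Real.fourierInv_eq']
  have := Measure.integral_comp_smul_of_nonneg (volume : Measure (Space n))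
    (fun v => Complex.exp (↑(2 * Real.pi * inner ℝ v (ρ⁻¹ • z)) * Complex.I) • m v) ρ
    (hR := hρ.le)
  rw [finrank_euclideanSpace_fin] at this
  rw [← this]
  refine integral_congr_ae (ae_of_all _ fun v => ?_)
  simp only [dilate_apply]
  rw [real_inner_smul_left, real_inner_smul_right, ← mul_assoc ρ, mul_inv_cancel₀ hρ.ne', one_mul]

/-- The kernels are L¹-normalized dilates of one another, so moments measured in units of ρ are
independent of ρ. This makes the constants uniform in k. -/
theorem lintegral_dilatedKernel (m : 𝓢(Space n, ℂ)) {ρ : ℝ} (hρ : 0 < ρ) (f : ℝ → ℝ≥0∞) :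
    ∫⁻ z, ‖dilatedKernel m ρ z‖ₑ * f (‖z‖ / ρ) =
      ∫⁻ z, ‖dilatedKernel m 1 z‖ₑ * f ‖z‖ := by
  have := lintegral_comp_smul (n := n) (fun z => ‖dilatedKernel m 1 z‖ₑ * f ‖z‖) (inv_pos.2 hρ)
  rw [inv_pow, inv_inv] at this
  have h2 : ∫⁻ z, ‖dilatedKernel m ρ z‖ₑ * f (‖z‖ / ρ) =
      ENNReal.ofReal (ρ ^ n)⁻¹ *
        ∫⁻ z, ‖dilatedKernel m 1 (ρ⁻¹ • z)‖ₑ * f ‖ρ⁻¹ • z‖ := by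
    rw [← lintegral_const_mul' _ _ ENNReal.ofReal_ne_top]
    refine lintegral_congr fun z => ?_
    rw [norm_smul, norm_inv, Real.norm_of_nonneg hρ.le, inv_mul_eq_div, ← mul_assoc]
    simp only [dilatedKernel, one_pow, inv_one, one_smul]
    rw [enorm_smul, Real.enorm_of_nonneg (by positivity)]
  rw [h2, this, ← mul_assoc, ← ENNReal.ofReal_mul (by positivity), inv_mul_cancel₀ (by positivity),
    ENNReal.ofReal_one, one_mul]

theorem lintegral_dilatedKernel_one_lt_top (m : 𝓢(Space n, ℂ)) :
    ∫⁻ z, ‖dilatedKernel m 1 z‖ₑ * ENNReal.ofReal (1 + ‖z‖) < ⊤ := by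
  set K : 𝓢(Space n, ℂ) := FourierTransform.fourierInv m with hK
  have h0 := (K.integrable_pow_mul volume 0).add (K.integrable_pow_mul volume 1)
  refine lt_of_le_of_lt (lintegral_mono fun z => ?_) h0.lintegral_lt_top
  simp only [dilatedKernel, one_pow, inv_one, one_smul, pow_zero, one_mul, pow_one, Pi.add_apply]
  rw [← ofReal_norm, ← ENNReal.ofReal_mul (norm_nonneg _)]
  refine ENNReal.ofReal_le_ofReal (le_of_eq ?_)
  rw [← hK]
  ring

/-- Decay of order 2 suffices: it exceeds the critical order 1 for integrating a Morrey density. -/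
theorem exists_norm_dilatedKernel_le (m : 𝓢(Space n, ℂ)) :
    ∃ D : ℝ, 0 ≤ D ∧ ∀ {ρ : ℝ}, 0 < ρ → ∀ z, ‖dilatedKernel m ρ z‖ ≤
      D * (ρ ^ n)⁻¹ * (1 + ‖z‖ / ρ) ^ (-2 : ℝ) := by
  set K : 𝓢(Space n, ℂ) := FourierTransform.fourierInv m with hK
  refine ⟨2 ^ 2 * ((Finset.Iic (2, 0)).sup fun m => SchwartzMap.seminorm ℝ m.1 m.2) K, by positivity,
    fun {ρ} hρ z => ?_⟩
  have h := SchwartzMap.one_add_le_sup_seminorm_apply (𝕜 := ℝ) (m := (2, 0)) (k := 2) (n := 0)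
    le_rfl le_rfl K (ρ⁻¹ • z)
  rw [norm_iteratedFDeriv_zero, norm_smul, norm_inv, Real.norm_of_nonneg hρ.le, inv_mul_eq_div] at h
  rw [dilatedKernel, norm_smul, Real.norm_of_nonneg (by positivity), mul_comm _ (ρ ^ n)⁻¹, mul_assoc]
  gcongr
  rw [Real.rpow_neg (by positivity), ← div_eq_mul_inv, le_div_iff₀ (by positivity), mul_comm]
  exact_mod_cast h

/-! ### Distributions given by functions -/

theorem IsGivenBy.congr {u : TimeDist n} {f g : ℝ × Space n → ℂ} (h : IsGivenBy u f)
    (hfg : f =ᵐ[spaceTime n] g) : IsGivenBy u g := by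
  refine ⟨h.1.congr hfg, ?_⟩
  filter_upwards [h.2, Measure.ae_ae_of_ae_prod hfg] with t ht hfgt η
  have : (fun x => η x * f (t, x)) =ᵐ[volume] fun x => η x * g (t, x) := by
    filter_upwards [hfgt] with x hx
    rw [hx]
  exact ⟨(ht η).1.congr this, (ht η).2.trans (integral_congr_ae this)⟩

theorem IsGivenBy.finset_sum {ι : Type*} {s : Finset ι} {u : ι → TimeDist n}
    {f : ι → ℝ × Space n → ℂ} (h : ∀ i ∈ s, IsGivenBy (u i) (f i)) :
    IsGivenBy (fun t => ∑ i ∈ s, u i t) (fun p => ∑ i ∈ s, f i p) := by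
  refine ⟨Finset.aestronglyMeasurable_fun_sum _ fun i hi => (h i hi).1, ?_⟩
  filter_upwards [(Finset.eventually_all s).2 fun i hi => (h i hi).2] with t ht η
  simp only [Finset.mul_sum]
  refine ⟨integrable_finsetSum _ fun i hi => (ht i hi η).1, ?_⟩
  rw [integral_finsetSum _ fun i hi => (ht i hi η).1, sum_apply]
  exact Finset.sum_congr rfl fun i hi => (ht i hi η).2

theorem IsGivenBy.const_smul {u : TimeDist n} {f : ℝ × Space n → ℂ} (h : IsGivenBy u f) (c : ℂ) :
    IsGivenBy (fun t => c • u t) (fun p => c * f p) := by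
  refine ⟨h.1.const_mul c, ?_⟩
  filter_upwards [h.2] with t ht η
  simp only [mul_left_comm _ c]
  refine ⟨(ht η).1.const_mul c, ?_⟩
  rw [integral_const_mul, ← (ht η).2]
  rfl

/-- A locally integrable function whose products with Schwartz functions have vanishing integrals
is zero. -/
theorem ae_eq_of_schwartz {f g : Space n → ℂ}
    (hf : ∀ η : 𝓢(Space n, ℂ), Integrable fun x => η x * f x)
    (hg : ∀ η : 𝓢(Space n, ℂ), Integrable fun x => η x * g x)
    (h : ∀ η : 𝓢(Space n, ℂ), ∫ x, η x * f x = ∫ x, η x * g x) : f =ᵐ[volume] g := by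
  have hloc : ∀ {f : Space n → ℂ}, (∀ η : 𝓢(Space n, ℂ), Integrable fun x => η x * f x) →
      LocallyIntegrable f := by
    intro f hf
    rw [locallyIntegrable_iff]
    intro K hK
    obtain ⟨R, hR, hKR⟩ := hK.isBounded.exists_pos_norm_le
    -- Testing against a bump equal to 1 on K gives integrability on K.
    let χ : ContDiffBump (0 : Space n) := ⟨R, R + 1, hR, by linarith⟩
    have hχ₁ : HasCompactSupport (Complex.ofRealCLM ∘ χ) := χ.hasCompactSupport.comp_left rfl
    have hχ₂ : ContDiff ℝ ∞ (Complex.ofRealCLM ∘ χ) := Complex.ofRealCLM.contDiff.comp χ.contDiff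
    refine (hf (hχ₁.toSchwartzMap hχ₂)).integrableOn.congr_fun (fun x hx => ?_) hK.measurableSet
    have : χ x = 1 := χ.one_of_mem_closedBall (by simpa using hKR x hx)
    simp [this]
  refine ae_eq_of_integral_contDiff_smul_eq (hloc hf) (hloc hg) fun χ hχ hχc => ?_
  have hχ₁ : HasCompactSupport (Complex.ofRealCLM ∘ χ) := hχc.comp_left rfl
  have hχ₂ : ContDiff ℝ ∞ (Complex.ofRealCLM ∘ χ) := by fun_prop
  have := h (hχ₁.toSchwartzMap hχ₂)
  simpa [Complex.real_smul] using this

theorem IsGivenBy.ae_eq {u : TimeDist n} {f g : ℝ × Space n → ℂ} (hf : IsGivenBy u f)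
    (hg : IsGivenBy u g) : f =ᵐ[spaceTime n] g := by
  -- Passing from slicewise to joint almost-everywhere equality needs a measurable coincidence set,
  -- hence the measurable representatives.
  have hf' := hf.congr hf.1.ae_eq_mk
  have hg' := hg.congr hg.1.ae_eq_mk
  refine hf.1.ae_eq_mk.trans (Filter.EventuallyEq.trans ?_ hg.1.ae_eq_mk.symm)
  refine (Measure.ae_prod_iff_ae_ae (measurableSet_eq_fun hf.1.stronglyMeasurable_mk.measurable
    hg.1.stronglyMeasurable_mk.measurable)).2 ?_
  filter_upwards [hf'.2, hg'.2] with t h1 h2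
  exact ae_eq_of_schwartz (fun η => (h1 η).1) (fun η => (h2 η).1)
    fun η => (h1 η).2.symm.trans (h2 η).2

theorem XkFun_congr {f g : ℝ × Space n → ℂ} (h : f =ᵐ[spaceTime n] g) (k : ℤ) :
    XkFun k f = XkFun k g := by
  have h2 : ∀ B : Set (ℝ × Space n), weightedL2On (-(1 / 2)) B f = weightedL2On (-(1 / 2)) B g :=
    fun B => eLpNorm_congr_ae <| by
      filter_upwards [ae_restrict_of_ae h] with p hp
      rw [hp]
  rw [XkFun, XkFun, eLpNorm_congr_ae (ae_restrict_of_ae h)]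
  simp_rw [h2]

/-- Representatives agree almost everywhere, so the defining infimum ranges over a single value. -/
theorem Xk_eq {u : TimeDist n} {f : ℝ × Space n → ℂ} (h : IsGivenBy u f) (k : ℤ) :
    Xk k u = XkFun k f :=
  le_antisymm (iInf₂_le _ h) (le_iInf₂ fun _ hg => (XkFun_congr (h.ae_eq hg) k).le)

theorem exists_isGivenBy_of_Xk_lt_top {u : TimeDist n} {k : ℤ} (h : Xk k u < ⊤) :
    ∃ f, IsGivenBy u f := by
  by_contra! hne
  simp [Xk, hne] at h

/-- A function that is square integrable with a polynomial weight is integrable against Schwartz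
functions. -/
theorem lintegral_schwartz_mul_lt_top {w H : Space n → ℝ≥0∞} {c : ℝ≥0∞} (N : ℕ) (hc : c ≠ ⊤)
    (hw : Measurable w) (hH : Measurable H)
    (hwN : ∀ᵐ x, w x ≠ 0 ∧ w x ≠ ⊤ ∧ (w x)⁻¹ ≤ c * ENNReal.ofReal ((1 + ‖x‖) ^ N))
    (h : ∫⁻ x, w x * H x ^ 2 < ⊤) (η : 𝓢(Space n, ℂ)) : ∫⁻ x, ‖η x‖ₑ * H x < ⊤ := by
  -- Inserting w^(-1/2) w^(1/2) prepares Cauchy–Schwarz; the polynomially growing w⁻¹ is absorbed by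
  -- η.
  have h1 : ∫⁻ x, ‖η x‖ₑ * H x =
      ∫⁻ x, (‖η x‖ₑ * (w x)⁻¹ ^ (1 / 2 : ℝ)) * (w x ^ (1 / 2 : ℝ) * H x) := by
    refine lintegral_congr_ae ?_
    filter_upwards [hwN] with x hx
    have : (w x)⁻¹ ^ (1 / 2 : ℝ) * w x ^ (1 / 2 : ℝ) = 1 := by
      rw [← ENNReal.mul_rpow_of_nonneg _ _ (by norm_num), ENNReal.inv_mul_cancel hx.1 hx.2.1,
        ENNReal.one_rpow]
    rw [mul_assoc, ← mul_assoc ((w x)⁻¹ ^ (1 / 2 : ℝ)), this, one_mul]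
  have hsq : ∀ a : ℝ≥0∞, (a ^ (1 / 2 : ℝ)) ^ 2 = a := fun a => by
    rw [← ENNReal.rpow_natCast, ← ENNReal.rpow_mul]
    norm_num
  have h2 : (∫⁻ x, ‖η x‖ₑ * H x) ^ 2 < ⊤ := by
    rw [h1]
    refine lt_of_le_of_lt (lintegral_mul_sq_le ?_ ?_) ?_
    · exact Measurable.aemeasurable (by fun_prop)
    · exact Measurable.aemeasurable (by fun_prop)
    · simp only [mul_pow, hsq]
      refine ENNReal.mul_lt_top ?_ h
      calc _ ≤ ∫⁻ x, c * (ENNReal.ofReal ((1 + ‖x‖) ^ N) * ‖η x‖ₑ ^ 2) := by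
            refine lintegral_mono_ae ?_
            filter_upwards [hwN] with x hx
            rw [mul_comm, ← mul_assoc]
            gcongr
            exact hx.2.2
        _ < ⊤ := by
          rw [lintegral_const_mul' _ _ hc]
          exact ENNReal.mul_lt_top hc.lt_top (schwartz_lintegral_weight_lt_top η N)
  by_contra htop
  rw [not_lt_top_iff.1 htop] at h2
  simp at h2

/-- Convolution of a space-time function with the kernel of the multiplier `m (ρ D)`. -/
def kernelConv (m : 𝓢(Space n, ℂ)) (ρ : ℝ) (h : ℝ × Space n → ℂ) (p : ℝ × Space n) : ℂ :=
  ∫ z, dilatedKernel m ρ z * h (p.1, p.2 - z)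

theorem measurable_kernelConv (m : 𝓢(Space n, ℂ)) (ρ : ℝ) {h : ℝ × Space n → ℂ}
    (hh : Measurable h) : Measurable (kernelConv m ρ h) := by
  have hK := (continuous_dilatedKernel m ρ).measurable
  have : StronglyMeasurable (Function.uncurry fun (p : ℝ × Space n) (z : Space n) =>
      dilatedKernel m ρ z * h (p.1, p.2 - z)) := by
    refine Measurable.stronglyMeasurable ?_
    simp only [Function.uncurry_def]
    fun_prop
  exact this.integral_prod_right.measurable

theorem enorm_kernelConv_le (m : 𝓢(Space n, ℂ)) (ρ : ℝ) (h : ℝ × Space n → ℂ) (p : ℝ × Space n) :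
    ‖kernelConv m ρ h p‖ₑ ≤ ∫⁻ z, ‖dilatedKernel m ρ z‖ₑ * ‖h (p.1, p.2 - z)‖ₑ := by
  refine (enorm_integral_le_lintegral_enorm _).trans (le_of_eq ?_)
  simp only [enorm_mul]

/-- Cauchy–Schwarz for the measure |K(z)| dz. It dominates the squared convolution by a convolution
of |h|², which `MorreyBound.conv` can treat. -/
theorem lintegral_kernel_sq_le (m : 𝓢(Space n, ℂ)) {ρ : ℝ} (hρ : 0 < ρ) {h : ℝ × Space n → ℂ}
    (hh : Measurable h) (p : ℝ × Space n) :
    (∫⁻ z, ‖dilatedKernel m ρ z‖ₑ * ‖h (p.1, p.2 - z)‖ₑ) ^ 2 ≤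
      (∫⁻ z, ‖dilatedKernel m 1 z‖ₑ) *
        ∫⁻ z, ‖dilatedKernel m ρ z‖ₑ * ‖h (p.1, p.2 - z)‖ₑ ^ 2 := by
  have hK := (continuous_dilatedKernel m ρ).measurable
  have hsq : ∀ a : ℝ≥0∞, (a ^ (1 / 2 : ℝ)) ^ 2 = a := fun a => by
    rw [← ENNReal.rpow_natCast, ← ENNReal.rpow_mul]
    norm_num
  have h1 := lintegral_mul_sq_le (μ := (volume : Measure (Space n)))
    (f := fun z => ‖dilatedKernel m ρ z‖ₑ ^ (1 / 2 : ℝ))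
    (g := fun z => ‖dilatedKernel m ρ z‖ₑ ^ (1 / 2 : ℝ) * ‖h (p.1, p.2 - z)‖ₑ)
    (Measurable.aemeasurable (by fun_prop)) (Measurable.aemeasurable (by fun_prop))
  have h2 := lintegral_dilatedKernel m hρ fun _ => 1
  simp only [mul_one] at h2
  simp only [mul_pow, hsq] at h1
  rw [h2] at h1
  refine le_trans (le_of_eq ?_) h1
  congr 2 with z
  rw [← mul_assoc, ← sq, hsq]

theorem lintegral_dilatedKernel_one_ne_top (m : 𝓢(Space n, ℂ)) :
    ∫⁻ z, ‖dilatedKernel m 1 z‖ₑ ≠ ⊤ := by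
  refine (lt_of_le_of_lt (lintegral_mono fun z => ?_) (lintegral_dilatedKernel_one_lt_top m)).ne
  refine le_mul_of_one_le_right zero_le ?_
  rw [ENNReal.one_le_ofReal]
  linarith [norm_nonneg z]

/-- `m (ρ D)` acts on functions with a Morrey bound by convolution with its kernel. -/
theorem IsGivenBy.fourierMultiplier (m : 𝓢(Space n, ℂ)) {ρ : ℝ} (hρ : 0 < ρ) {u : TimeDist n}
    {h : ℝ × Space n → ℂ} (hh : Measurable h) (hu : IsGivenBy u h)
    (hfin : ∀ᵐ t ∂(volume.restrict (Ioi (0 : ℝ))), ∫⁻ x, ENNReal.ofReal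
      (max 1 (‖x‖ / ρ) ^ (-(1 + 1) : ℝ)) *
        (∫⁻ z, ‖dilatedKernel m ρ z‖ₑ * ‖h (t, x - z)‖ₑ) ^ 2 < ⊤) :
    IsGivenBy (fun t => TemperedDistribution.fourierMultiplierCLM ℂ (fun ξ => m (ρ • ξ)) (u t))
      (kernelConv m ρ h) := by
  have hK := (continuous_dilatedKernel m ρ).measurable
  refine ⟨(measurable_kernelConv m ρ hh).aestronglyMeasurable, ?_⟩
  filter_upwards [hu.2, hfin] with t ht hfint η
  have hfub : ∫⁻ x, ‖η x‖ₑ * ∫⁻ z, ‖dilatedKernel m ρ z‖ₑ * ‖h (t, x - z)‖ₑ < ⊤ := by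
    -- The constant comes from max(1, ‖x‖/ρ) ≤ (1 + ρ⁻¹)(1 + ‖x‖).
    refine lintegral_schwartz_mul_lt_top 2 (c := ENNReal.ofReal ((1 + ρ⁻¹) ^ 2))
      ENNReal.ofReal_ne_top ?_ ?_ ?_ hfint η
    · fun_prop
    · fun_prop
    · refine ae_of_all _ fun x => ⟨?_, ENNReal.ofReal_ne_top, ?_⟩
      · rw [ne_eq, ENNReal.ofReal_eq_zero, not_le]
        positivity
      · rw [← ENNReal.ofReal_inv_of_pos (by positivity), ← ENNReal.ofReal_mul (by positivity)]
        refine ENNReal.ofReal_le_ofReal ?_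
        rw [← Real.rpow_neg (by positivity), neg_neg, ← mul_pow,
          show (1 + 1 : ℝ) = ((2 : ℕ) : ℝ) by norm_num, Real.rpow_natCast]
        gcongr
        have : 0 < ρ⁻¹ := by positivity
        rw [div_eq_mul_inv]
        refine max_le ?_ ?_ <;> nlinarith [norm_nonneg x, mul_nonneg (norm_nonneg x) this.le]
  have hη : Measurable η := η.continuous.measurable
  have hint : Integrable (fun q : Space n × Space n =>
      η q.1 * (dilatedKernel m ρ (q.1 - q.2) * h (t, q.2))) (volume.prod volume) := by
    refine ⟨Measurable.aestronglyMeasurable (by fun_prop), ?_⟩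
    rw [hasFiniteIntegral_iff_enorm, lintegral_prod _ (Measurable.aemeasurable (by fun_prop))]
    refine lt_of_le_of_lt (le_of_eq ?_) hfub
    refine lintegral_congr fun x => ?_
    simp only [enorm_mul]
    rw [lintegral_const_mul _ (by fun_prop), ← lintegral_sub_left_eq_self _ x]
    simp only [sub_sub_cancel]
  have hconv : ∀ x, kernelConv m ρ h (t, x) = ∫ y, dilatedKernel m ρ (x - y) * h (t, y) := by
    intro x
    rw [kernelConv, ← integral_sub_left_eq_self _ volume x]
    simp only [sub_sub_cancel]
  have hprod : ∀ x, η x * kernelConv m ρ h (t, x) =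
      ∫ y, η x * (dilatedKernel m ρ (x - y) * h (t, y)) := fun x => by
    rw [hconv, integral_const_mul]
  refine ⟨?_, ?_⟩
  · simp_rw [hprod]
    exact hint.integral_prod_left
  · simp_rw [hprod]
    rw [integral_integral_swap hint, TemperedDistribution.fourierMultiplierCLM_apply_apply,
      (ht _).2]
    refine integral_congr_ae (ae_of_all _ fun y => ?_)
    have := fourier_smulLeft_fourierInv_apply (dilate m hρ) η y
    change (FourierTransform.fourier (SchwartzMap.smulLeftCLM ℂ (dilate m hρ)
      (FourierTransform.fourierInv η)) : 𝓢(Space n, ℂ)) y * h (t, y) = _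
    rw [this, ← integral_mul_const]
    refine integral_congr_ae (ae_of_all _ fun x => ?_)
    simp only [fourierInv_dilate]
    ring

/-- Multipliers with Schwartz symbol at scale `ρ` preserve Morrey bounds, and they produce functions
that are bounded in `{|x| ≤ ρ}`. -/
theorem exists_kernelConv_bound (m : 𝓢(Space n, ℂ)) : ∃ C : ℝ≥0, ∀ {ρ : ℝ}, 0 < ρ →
    ∀ {u : TimeDist n} {h : ℝ × Space n → ℂ} {B : ℝ≥0∞}, B ≠ ⊤ → Measurable h → IsGivenBy u h →
    MorreyBound ρ (fun p => ‖h p‖ₑ ^ 2) B →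
    IsGivenBy (fun t => TemperedDistribution.fourierMultiplierCLM ℂ (fun ξ => m (ρ • ξ)) (u t))
        (kernelConv m ρ h) ∧
      MorreyBound ρ (fun p => ‖kernelConv m ρ h p‖ₑ ^ 2) (C * B) ∧
      ∃ N : ℝ → ℝ≥0∞, Measurable N ∧
        (∀ t x, ‖x‖ ≤ ρ → ‖kernelConv m ρ h (t, x)‖ₑ ^ 2 ≤ N t) ∧
        ∫⁻ t in Ioi (0 : ℝ), N t ≤ C * (ENNReal.ofReal (ρ * (ρ ^ n)⁻¹) * B) := by
  set c₀ : ℝ≥0∞ := ∫⁻ z, ‖dilatedKernel m 1 z‖ₑ with hc₀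
  set c₁ : ℝ≥0∞ := ∫⁻ z, ‖dilatedKernel m 1 z‖ₑ * ENNReal.ofReal (1 + ‖z‖) with hc₁
  have hc₀t : c₀ ≠ ⊤ := lintegral_dilatedKernel_one_ne_top m
  have hc₁t : c₁ ≠ ⊤ := (lintegral_dilatedKernel_one_lt_top m).ne
  obtain ⟨D, hD0, hD⟩ := exists_norm_dilatedKernel_le m
  obtain ⟨C₁, hC₁⟩ := MorreyBound.lintegral_weight_le one_pos
  set C : ℝ≥0∞ := max (c₀ * c₁) (c₀ * (ENNReal.ofReal (D * 4) * C₁)) with hC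
  have hCt : C ≠ ⊤ := by
    have h1 : c₀ * c₁ ≠ ⊤ := ENNReal.mul_ne_top hc₀t hc₁t
    have h2 : c₀ * (ENNReal.ofReal (D * 4) * C₁) ≠ ⊤ := by finiteness
    exact (max_lt h1.lt_top h2.lt_top).ne
  refine ⟨C.toNNReal, fun {ρ} hρ {u h B} hB hh hu hM => ?_⟩
  rw [ENNReal.coe_toNNReal hCt]
  have hK := (continuous_dilatedKernel m ρ).measurable
  have hF : Measurable fun p : ℝ × Space n => ‖h p‖ₑ ^ 2 := by fun_prop
  -- Bounding the convolution of absolute values serves twice: it gives the absolute convergence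
  -- needed for Fubini, and it dominates `kernelConv`.
  have hHM : MorreyBound ρ (fun p : ℝ × Space n =>
      (∫⁻ z, ‖dilatedKernel m ρ z‖ₑ * ‖h (p.1, p.2 - z)‖ₑ) ^ 2) (C * B) := by
    have h1 := (hM.conv hρ hF (G := fun z => ‖dilatedKernel m ρ z‖ₑ) (by fun_prop)).const_mul hc₀t
    rw [lintegral_dilatedKernel m hρ fun s => ENNReal.ofReal (1 + s), ← mul_assoc] at h1
    refine h1.mono (ae_of_all _ fun p => lintegral_kernel_sq_le m hρ hh p) ?_
    gcongr
    exact le_max_left _ _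
  refine ⟨IsGivenBy.fourierMultiplier m hρ hh hu ?_, ?_, ?_⟩
  · have hmeas : Measurable fun p : ℝ × Space n =>
        ENNReal.ofReal (max 1 (‖p.2‖ / ρ) ^ (-(1 + 1) : ℝ)) *
          (∫⁻ z, ‖dilatedKernel m ρ z‖ₑ * ‖h (p.1, p.2 - z)‖ₑ) ^ 2 := by fun_prop
    have h1 := hC₁ hρ (Measurable.aemeasurable (by fun_prop)) hHM
    rw [spaceTime, lintegral_prod _ hmeas.aemeasurable] at h1
    refine ae_lt_top ?_ (ne_top_of_le_ne_top ?_ h1)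
    · exact hmeas.lintegral_prod_right'
    · finiteness
  · exact hHM.mono (ae_of_all _ fun p => by gcongr; exact enorm_kernelConv_le m ρ h p) le_rfl
  · set W : ℝ × Space n → ℝ≥0∞ := fun p =>
      ENNReal.ofReal (max 1 (‖p.2‖ / ρ) ^ (-(1 + 1) : ℝ)) * ‖h p‖ₑ ^ 2 with hW
    have hWm : Measurable W := by fun_prop
    -- For ‖x‖ ≤ ρ the kernel at x − y is at most 4Dρ⁻ⁿ max(1, ‖y‖/ρ)⁻², so one integral in y serves
    -- all such x. Its time integral is a weighted Morrey integral.
    refine ⟨fun t => c₀ * ENNReal.ofReal (D * 4 * (ρ ^ n)⁻¹) * ∫⁻ y, W (t, y), ?_, ?_, ?_⟩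
    · exact hWm.lintegral_prod_right'.const_mul _
    · intro t x hx
      calc _ ≤ (∫⁻ z, ‖dilatedKernel m ρ z‖ₑ * ‖h (t, x - z)‖ₑ) ^ 2 := by
            gcongr
            exact enorm_kernelConv_le m ρ h (t, x)
        _ ≤ c₀ * ∫⁻ z, ‖dilatedKernel m ρ z‖ₑ * ‖h (t, x - z)‖ₑ ^ 2 :=
            lintegral_kernel_sq_le m hρ hh (t, x)
        _ = c₀ * ∫⁻ y, ‖dilatedKernel m ρ (x - y)‖ₑ * ‖h (t, y)‖ₑ ^ 2 := by
            rw [← lintegral_sub_left_eq_self _ x]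
            simp only [sub_sub_cancel]
        _ ≤ c₀ * ∫⁻ y, ENNReal.ofReal (D * 4 * (ρ ^ n)⁻¹) * W (t, y) := by
            gcongr c₀ * ?_
            refine lintegral_mono fun y => ?_
            rw [hW, ← mul_assoc, ← ENNReal.ofReal_mul (by positivity)]
            gcongr ?_ * _
            rw [← ofReal_norm]
            refine ENNReal.ofReal_le_ofReal ((hD hρ (x - y)).trans ?_)
            have h1 : max 1 (‖y‖ / ρ) ≤ 2 * (1 + ‖x - y‖ / ρ) := by
              have hxy : ‖y‖ ≤ ‖x - y‖ + ‖x‖ := by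
                rw [norm_sub_rev]
                simpa using norm_add_le (y - x) x
              have h0 : 0 ≤ ‖x - y‖ / ρ := by positivity
              refine max_le (by linarith) ?_
              rw [div_le_iff₀ hρ]
              have : ‖x - y‖ / ρ * ρ = ‖x - y‖ := div_mul_cancel₀ _ hρ.ne'
              nlinarith [norm_nonneg (x - y)]
            have h2 : (1 + ‖x - y‖ / ρ) ^ (-2 : ℝ) ≤ 4 * max 1 (‖y‖ / ρ) ^ (-(1 + 1) : ℝ) := by
              rw [show (-(1 + 1) : ℝ) = -2 by norm_num]
              calc (1 + ‖x - y‖ / ρ) ^ (-2 : ℝ)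
                  = 4 * (2 * (1 + ‖x - y‖ / ρ)) ^ (-2 : ℝ) := by
                    rw [Real.mul_rpow (by norm_num) (by positivity), ← mul_assoc]
                    norm_num [Real.rpow_neg]
                _ ≤ _ := by
                    gcongr 4 * ?_
                    exact Real.rpow_le_rpow_of_nonpos (by positivity) h1 (by norm_num)
            calc _ ≤ D * (ρ ^ n)⁻¹ * (4 * max 1 (‖y‖ / ρ) ^ (-(1 + 1) : ℝ)) := by gcongr
              _ = _ := by ring
        _ = c₀ * ENNReal.ofReal (D * 4 * (ρ ^ n)⁻¹) * ∫⁻ y, W (t, y) := by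
            rw [lintegral_const_mul' _ _ ENNReal.ofReal_ne_top, ← mul_assoc]
    · have h1 := hC₁ hρ hF.aemeasurable hM
      rw [spaceTime, lintegral_prod _ hWm.aemeasurable] at h1
      rw [lintegral_const_mul _ hWm.lintegral_prod_right']
      calc _ ≤ c₀ * ENNReal.ofReal (D * 4 * (ρ ^ n)⁻¹) * (C₁ * ENNReal.ofReal ρ * B) := by gcongr
        _ = c₀ * (ENNReal.ofReal (D * 4) * C₁) * (ENNReal.ofReal (ρ * (ρ ^ n)⁻¹) * B) := by
            rw [ENNReal.ofReal_mul (by positivity), ENNReal.ofReal_mul hρ.le]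
            ring
        _ ≤ _ := by
            gcongr
            exact le_max_right _ _

/-! ### Weighted estimates for a single frequency and their summation -/

theorem lintegral_cylinder_rpow {ρ : ℝ} (hρ : 0 < ρ) (b : ℝ) :
    ∫⁻ x in {x : Space n | ‖x‖ ≤ ρ}, ENNReal.ofReal ((‖x‖ / ρ) ^ (-b)) =
      ENNReal.ofReal (ρ ^ n) *
        ∫⁻ x in {x : Space n | ‖x‖ ≤ 1}, ENNReal.ofReal (‖x‖ ^ (-b)) := by
  have hm : ∀ R : ℝ, MeasurableSet {x : Space n | ‖x‖ ≤ R} := fun R =>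
    measurableSet_le (by fun_prop) (by fun_prop)
  have := lintegral_comp_smul (n := n) ({x : Space n | ‖x‖ ≤ 1}.indicator fun x =>
    ENNReal.ofReal (‖x‖ ^ (-b))) (inv_pos.2 hρ)
  rw [inv_pow, inv_inv, lintegral_indicator (hm 1)] at this
  rw [← this, ← lintegral_indicator (hm ρ)]
  refine lintegral_congr fun x => ?_
  have hx : ‖ρ⁻¹ • x‖ = ‖x‖ / ρ := by
    rw [norm_smul, norm_inv, Real.norm_of_nonneg hρ.le, inv_mul_eq_div]
  simp only [indicator, mem_ofPred_eq, hx, div_le_one hρ]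

/-- The weighted estimate for a function at frequency `1/ρ`, with a gain away from `|x| = ρ`. -/
theorem exists_weighted_bound {δ ε : ℝ} (hn : 1 ≤ n) (hε : 0 < ε) (hεδ : ε < 2 * δ)
    (hεn : 1 + 2 * δ + ε < n) : ∃ C : ℝ≥0, ∀ {ρ : ℝ}, 0 < ρ →
      ∀ {f : ℝ × Space n → ℂ} {N : ℝ → ℝ≥0∞} {B : ℝ≥0∞}, Measurable f → Measurable N →
      MorreyBound ρ (fun p => ‖f p‖ₑ ^ 2) B → (∀ t x, ‖x‖ ≤ ρ → ‖f (t, x)‖ₑ ^ 2 ≤ N t) →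
      ∫⁻ t in Ioi (0 : ℝ), N t ≤ ENNReal.ofReal (ρ * (ρ ^ n)⁻¹) * B →
      ∫⁻ p, ENNReal.ofReal (‖p.2‖ ^ (-1 - 2 * δ)) *
        (ENNReal.ofReal (max (‖p.2‖ / ρ) (‖p.2‖ / ρ)⁻¹ ^ ε) * ‖f p‖ₑ ^ 2) ∂spaceTime n ≤
        C * ENNReal.ofReal (ρ ^ (-2 * δ)) * B := by
  -- Outside the ball the gain costs ε of decay, leaving order 1 + (2δ − ε), still above 1; inside
  -- it raises the singularity to order 1 + 2δ + ε, still below n.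
  obtain ⟨C₁, hC₁⟩ := MorreyBound.lintegral_weight_le (a := 2 * δ - ε) (by linarith)
  set I : ℝ≥0∞ := ∫⁻ x in {x : Space n | ‖x‖ ≤ 1}, ENNReal.ofReal (‖x‖ ^ (-(1 + 2 * δ + ε)))
    with hI
  have hIt : I ≠ ⊤ := (lintegral_ball_norm_rpow_lt_top hn hεn).ne
  refine ⟨C₁ + I.toNNReal, fun {ρ} hρ {f N B} hf hN hM hfN hNB => ?_⟩
  rw [ENNReal.coe_add, ENNReal.coe_toNNReal hIt]
  have hm : MeasurableSet {x : Space n | ‖x‖ ≤ ρ} := measurableSet_le (by fun_prop) (by fun_prop)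
  set g : Space n → ℝ≥0∞ := {x : Space n | ‖x‖ ≤ ρ}.indicator fun x =>
    ENNReal.ofReal ((‖x‖ / ρ) ^ (-(1 + 2 * δ + ε))) with hg
  have hgm : Measurable g := Measurable.indicator (by fun_prop) hm
  have hpt : ∀ p : ℝ × Space n, ENNReal.ofReal (‖p.2‖ ^ (-1 - 2 * δ)) *
      (ENNReal.ofReal (max (‖p.2‖ / ρ) (‖p.2‖ / ρ)⁻¹ ^ ε) * ‖f p‖ₑ ^ 2) ≤
      ENNReal.ofReal (ρ ^ (-1 - 2 * δ)) *
        (ENNReal.ofReal (max 1 (‖p.2‖ / ρ) ^ (-(1 + (2 * δ - ε)))) * ‖f p‖ₑ ^ 2 +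
          N p.1 * g p.2) := by
    intro p
    rcases eq_or_ne p.2 0 with h0 | h0
    -- At the origin the left side is zero: 0⁻¹ = 0 makes the maximum vanish, and 0 ^ ε = 0.
    · simp [h0, Real.zero_rpow hε.ne']
    have hp : 0 < ‖p.2‖ := norm_pos_iff.2 h0
    set s : ℝ := ‖p.2‖ / ρ with hs
    have hs0 : 0 < s := by positivity
    have hps : ‖p.2‖ = ρ * s := by rw [hs]; field_simp
    rw [hps, Real.mul_rpow hρ.le hs0.le, ENNReal.ofReal_mul (by positivity), mul_assoc]
    gcongr
    rw [← mul_assoc, ← ENNReal.ofReal_mul (by positivity)]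
    rcases le_or_gt ‖p.2‖ ρ with hle | hlt
    · have hs1 : s ≤ 1 := (div_le_one hρ).2 hle
      refine le_trans ?_ le_add_self
      rw [hg, indicator_of_mem (show p.2 ∈ {x : Space n | ‖x‖ ≤ ρ} from hle), mul_comm (N p.1)]
      gcongr ENNReal.ofReal ?_ * ?_
      · rw [max_eq_right (hs1.trans ((one_le_inv₀ hs0).2 hs1)), Real.inv_rpow hs0.le,
          ← Real.rpow_neg hs0.le, ← Real.rpow_add hs0]
        refine le_of_eq ?_
        congr 1
        ring
      · exact hfN p.1 p.2 hle
    · have hs1 : 1 ≤ s := (one_le_div hρ).2 hlt.le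
      refine le_trans ?_ le_self_add
      rw [max_eq_left ((inv_le_one_of_one_le₀ hs1).trans hs1), max_eq_right hs1, ← Real.rpow_add hs0]
      refine le_of_eq ?_
      congr 3
      ring
  calc _ ≤ _ := lintegral_mono hpt
    _ = ENNReal.ofReal (ρ ^ (-1 - 2 * δ)) *
        ((∫⁻ p, ENNReal.ofReal (max 1 (‖p.2‖ / ρ) ^ (-(1 + (2 * δ - ε)))) * ‖f p‖ₑ ^ 2
          ∂spaceTime n) + (∫⁻ t in Ioi (0 : ℝ), N t) * ∫⁻ x, g x) := by
      rw [lintegral_const_mul' _ _ ENNReal.ofReal_ne_top, lintegral_add_left (by fun_prop)]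
      congr 2
      exact lintegral_prod_mul hN.aemeasurable hgm.aemeasurable
    _ ≤ ENNReal.ofReal (ρ ^ (-1 - 2 * δ)) * (C₁ * ENNReal.ofReal ρ * B +
        (ENNReal.ofReal (ρ * (ρ ^ n)⁻¹) * B) * (ENNReal.ofReal (ρ ^ n) * I)) := by
      gcongr
      · exact hC₁ hρ (Measurable.aemeasurable (by fun_prop)) hM
      · rw [hg, lintegral_indicator hm, lintegral_cylinder_rpow hρ]
    _ = _ := by
      -- The ρ⁻ⁿ of the pointwise bound cancels the volume factor ρⁿ, so the inner and outer parts
      -- scale alike.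
      have h1 : ENNReal.ofReal (ρ * (ρ ^ n)⁻¹) * ENNReal.ofReal (ρ ^ n) = ENNReal.ofReal ρ := by
        rw [← ENNReal.ofReal_mul (by positivity), mul_assoc, inv_mul_cancel₀ (by positivity), mul_one]
      have h2 : ENNReal.ofReal (ρ ^ (-2 * δ)) =
          ENNReal.ofReal (ρ ^ (-1 - 2 * δ)) * ENNReal.ofReal ρ := by
        rw [← ENNReal.ofReal_mul (by positivity)]
        nth_rw 3 [← Real.rpow_one ρ]
        rw [← Real.rpow_add hρ]
        congr 2
        ring
      calc _ = ENNReal.ofReal (ρ ^ (-1 - 2 * δ)) * (C₁ * ENNReal.ofReal ρ * B +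
            (ENNReal.ofReal (ρ * (ρ ^ n)⁻¹) * ENNReal.ofReal (ρ ^ n)) * B * I) := by ring
        _ = _ := by
          rw [h1, h2]
          ring

/-- With J the integer part of log₂ r, the terms decay geometrically in |k + J|; shifting the index
by J removes r. -/
theorem exists_tsum_rpow_le {ε : ℝ} (hε : 0 < ε) : ∃ C : ℝ≥0, ∀ r : ℝ, 0 < r →
    ∑' k : ℤ, ENNReal.ofReal (max (2 ^ k * r) (2 ^ k * r)⁻¹ ^ (-ε)) ≤ C := by
  have hq0 : (0 : ℝ) ≤ (2 : ℝ) ^ (-ε) := by positivity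
  have hq1 : (2 : ℝ) ^ (-ε) < 1 := Real.rpow_lt_one_of_one_lt_of_neg (by norm_num) (by linarith)
  have hsum : Summable fun k : ℤ => ((2 : ℝ) ^ (-ε)) ^ k.natAbs :=
    Summable.of_nat_of_neg (by simpa using summable_geometric_of_lt_one hq0 hq1)
      (by simpa using summable_geometric_of_lt_one hq0 hq1)
  refine ⟨(2 ^ ε * ∑' k : ℤ, ((2 : ℝ) ^ (-ε)) ^ k.natAbs).toNNReal, fun r hr => ?_⟩
  calc _ ≤ ∑' k : ℤ, ENNReal.ofReal (2 ^ ε * ((2 : ℝ) ^ (-ε)) ^ (k + Int.log 2 r).natAbs) := by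
        refine ENNReal.tsum_le_tsum fun k => ENNReal.ofReal_le_ofReal ?_
        have h1 : (2 : ℝ) ^ Int.log 2 r ≤ r := (two_zpow_le_iff hr _).2 le_rfl
        have h2 : r < (2 : ℝ) ^ (Int.log 2 r + 1) := lt_two_zpow_log_add_one
        set J := Int.log 2 r
        -- The −1 allows for r lying anywhere in [2^J, 2^(J+1)); it becomes the factor 2^ε.
        have h3 : (2 : ℝ) ^ (((k + J).natAbs : ℤ) - 1) ≤ max (2 ^ k * r) (2 ^ k * r)⁻¹ := by
          rcases le_or_gt 0 (k + J) with h | h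
          · refine le_trans ?_ (le_max_left _ _)
            calc (2 : ℝ) ^ (((k + J).natAbs : ℤ) - 1) ≤ 2 ^ (k + J) :=
                  zpow_le_zpow_right₀ (by norm_num) (by omega)
              _ = 2 ^ k * 2 ^ J := zpow_add₀ (by norm_num) _ _
              _ ≤ _ := by gcongr
          · refine le_trans ?_ (le_max_right _ _)
            rw [show ((k + J).natAbs : ℤ) - 1 = -(k + (J + 1)) by omega, zpow_neg,
              zpow_add₀ (by norm_num)]
            gcongr
        calc _ ≤ ((2 : ℝ) ^ (((k + J).natAbs : ℤ) - 1)) ^ (-ε) :=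
              Real.rpow_le_rpow_of_nonpos (by positivity) h3 (by linarith)
          _ = _ := by
            rw [← Real.rpow_natCast, ← Real.rpow_intCast, ← Real.rpow_mul (by norm_num),
              ← Real.rpow_mul (by norm_num), ← Real.rpow_add (by norm_num)]
            congr 1
            rw [Int.cast_sub, Int.cast_natCast, Int.cast_one]
            ring
    _ = ∑' k : ℤ, ENNReal.ofReal (2 ^ ε * ((2 : ℝ) ^ (-ε)) ^ k.natAbs) :=
        (Equiv.addRight (Int.log 2 r)).tsum_eq
          fun k : ℤ => ENNReal.ofReal (2 ^ ε * ((2 : ℝ) ^ (-ε)) ^ k.natAbs)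
    _ = _ := by
        rw [← ENNReal.ofReal_tsum_of_nonneg (fun l => by positivity) (hsum.mul_left _), tsum_mul_left]
        rfl

/-- Summation of weighted estimates with a gain away from `|x| = 2⁻ᵏ`. -/
theorem exists_lintegral_tsum_sq_le {ε : ℝ} (hn : 1 ≤ n) (hε : 0 < ε) : ∃ C : ℝ≥0,
    ∀ {f : ℤ → ℝ × Space n → ℂ} {w : Space n → ℝ≥0∞}, (∀ k, Measurable (f k)) → Measurable w →
      ∫⁻ p, w p.2 * (∑' k, ‖f k p‖ₑ) ^ 2 ∂spaceTime n ≤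
        C * ∑' k, ∫⁻ p, w p.2 * (ENNReal.ofReal
          (max (2 ^ k * ‖p.2‖) (2 ^ k * ‖p.2‖)⁻¹ ^ ε) * ‖f k p‖ₑ ^ 2) ∂spaceTime n := by
  obtain ⟨C, hC⟩ := exists_tsum_rpow_le hε
  refine ⟨C, fun {f w} hf hw => ?_⟩
  rw [← lintegral_tsum fun k => Measurable.aemeasurable (by fun_prop),
    ← lintegral_const_mul' _ _ ENNReal.coe_ne_top]
  refine lintegral_mono_ae ?_
  filter_upwards [ae_spaceTime_snd (ae_ne_zero hn)] with p hp
  have hr : 0 < ‖p.2‖ := norm_pos_iff.2 hp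
  rw [ENNReal.tsum_mul_left, mul_left_comm]
  gcongr
  refine le_trans ?_ (mul_le_mul_left (hC _ hr) _)
  set M : ℤ → ℝ := fun k => max (2 ^ k * ‖p.2‖) (2 ^ k * ‖p.2‖)⁻¹ with hM
  have hM0 : ∀ k, 0 < M k := fun k => lt_of_lt_of_le (by positivity) (le_max_left _ _)
  -- Splitting off M^(-ε/2) and applying Cauchy–Schwarz leaves the bounded sum of M^(-ε) times the
  -- sum with the gain M^ε.
  have h := tsum_mul_sq_le (fun k => ENNReal.ofReal (M k ^ (-(ε / 2))))
    fun k => ENNReal.ofReal (M k ^ (ε / 2)) * ‖f k p‖ₑ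
  have h1 : ∀ k, ENNReal.ofReal (M k ^ (-(ε / 2))) *
      (ENNReal.ofReal (M k ^ (ε / 2)) * ‖f k p‖ₑ) = ‖f k p‖ₑ := fun k => by
    have := hM0 k
    rw [← mul_assoc, ← ENNReal.ofReal_mul (by positivity), ← Real.rpow_add this]
    simp
  have h2 : ∀ k (a : ℝ), ENNReal.ofReal (M k ^ a) ^ 2 = ENNReal.ofReal (M k ^ (2 * a)) :=
    fun k a => by
      have := hM0 k
      rw [← ENNReal.ofReal_pow (by positivity), ← Real.rpow_mul_natCast this.le]
      congr 2
      push_cast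
      ring
  simp only [h1, mul_pow, h2] at h
  simpa only [mul_neg, mul_div_cancel₀ ε two_ne_zero] using h

end

section

variable {n : ℕ} {φ : Space n → ℝ}

/-! ### Littlewood–Paley projections -/

/-- The Littlewood–Paley profile as a Schwartz function. -/
def IsLittlewoodPaley.symbol (hφ : IsLittlewoodPaley φ) : 𝓢(Space n, ℂ) :=
  (show HasCompactSupport (Complex.ofRealCLM ∘ φ) from
    hφ.compactSupport.comp_left rfl).toSchwartzMap (Complex.ofRealCLM.contDiff.comp hφ.smooth)

theorem hasTemperateGrowth_dilate (m : 𝓢(Space n, ℂ)) {ρ : ℝ} (hρ : 0 < ρ) :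
    (fun ξ => m (ρ • ξ)).HasTemperateGrowth := (dilate m hρ).hasTemperateGrowth

theorem IsLittlewoodPaley.hasTemperateGrowth (hφ : IsLittlewoodPaley φ) (k : ℤ) :
    (fun ξ => ((φ ((2 : ℝ) ^ (-k) • ξ) : ℝ) : ℂ)).HasTemperateGrowth :=
  hasTemperateGrowth_dilate hφ.symbol (ρ := (2 : ℝ) ^ (-k)) (by positivity)

/-- A smooth cutoff that equals one on the support of `φ`, supported in an annulus. -/
theorem IsLittlewoodPaley.exists_cutoff (hφ : IsLittlewoodPaley φ) :
    ∃ χ : Space n → ℝ, ContDiff ℝ ∞ χ ∧ HasCompactSupport χ ∧ (∀ᶠ ξ in 𝓝 0, χ ξ = 0) ∧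
      ∀ ξ, φ ξ ≠ 0 → χ ξ = 1 := by
  obtain ⟨R, hR, hsupp⟩ := hφ.compactSupport.isCompact.isBounded.exists_pos_norm_lt
  -- Prescribing zero near the origin as well keeps χ/‖ξ‖² smooth.
  obtain ⟨χ, h0, h1, -⟩ := exists_contMDiffMap_zero_one_nhds_of_isClosed
    (modelWithCornersSelf ℝ (Space n)) (n := (⊤ : ℕ∞))
    (s := {0} ∪ (Metric.ball (0 : Space n) R)ᶜ) (t := tsupport φ)
    (isClosed_singleton.union Metric.isOpen_ball.isClosed_compl) (isClosed_tsupport φ) (by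
      rw [Set.disjoint_left]
      rintro ξ (rfl | hξ) hξ'
      · exact hφ.zero_notMem hξ'
      · exact hξ (by simpa using hsupp ξ hξ'))
  refine ⟨χ, χ.contMDiff.contDiff, ?_, ?_, fun ξ hξ => ?_⟩
  · refine HasCompactSupport.intro (isCompact_closedBall (0 : Space n) R) fun ξ hξ => ?_
    refine h0.self_of_nhdsSet ξ (Or.inr fun h => hξ (Metric.ball_subset_closedBall h))
  · have hmem : (0 : Space n) ∈ ({0} ∪ (Metric.ball (0 : Space n) R)ᶜ : Set (Space n)) :=
      mem_union_left _ (mem_singleton 0)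
    exact Filter.Eventually.filter_mono (nhds_le_nhdsSet hmem) h0
  · exact h1.self_of_nhdsSet ξ (subset_tsupport _ hξ)

theorem IsLittlewoodPaley.exists_symbol_mul_eq (hφ : IsLittlewoodPaley φ) :
    ∃ m : 𝓢(Space n, ℂ), ∀ ξ, (φ ξ : ℂ) * m ξ = φ ξ := by
  obtain ⟨χ, hχ1, hχ2, -, hχ⟩ := hφ.exists_cutoff
  refine ⟨(show HasCompactSupport (Complex.ofRealCLM ∘ χ) from
    hχ2.comp_left rfl).toSchwartzMap (Complex.ofRealCLM.contDiff.comp hχ1), fun ξ => ?_⟩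
  by_cases h : φ ξ = 0
  · simp [h]
  · simp [hχ ξ h]

/-- The symbols of the operators that recover a frequency-localized function from its gradient. -/
theorem IsLittlewoodPaley.exists_inverse_gradient (hφ : IsLittlewoodPaley φ) :
    ∃ m : Fin n → 𝓢(Space n, ℂ), ∀ ξ,
      (φ ξ : ℂ) * ∑ i, (2 * Real.pi * Complex.I) * ((ξ i : ℝ) : ℂ) * m i ξ = φ ξ := by
  obtain ⟨χ, hχ1, hχ2, hχ0, hχ⟩ := hφ.exists_cutoff
  have hsm : ContDiff ℝ ∞ fun ξ : Space n => χ ξ * (‖ξ‖ ^ 2)⁻¹ := by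
    rw [contDiff_iff_contDiffAt]
    intro ξ
    rcases eq_or_ne ξ 0 with rfl | hξ
    · refine (contDiffAt_const (c := (0 : ℝ))).congr_of_eventuallyEq ?_
      filter_upwards [hχ0] with ζ hζ
      simp [hζ]
    · exact hχ1.contDiffAt.mul ((contDiff_norm_sq ℝ).contDiffAt.inv (by simpa using hξ))
  have hc : ∀ i : Fin n, HasCompactSupport fun ξ : Space n =>
      ((χ ξ * (‖ξ‖ ^ 2)⁻¹ * ξ i : ℝ) : ℂ) * (2 * Real.pi * Complex.I)⁻¹ := fun i =>
    hχ2.mono fun ξ hξ h => hξ (by simp [h])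
  have hd : ∀ i : Fin n, ContDiff ℝ ∞ fun ξ : Space n =>
      ((χ ξ * (‖ξ‖ ^ 2)⁻¹ * ξ i : ℝ) : ℂ) * (2 * Real.pi * Complex.I)⁻¹ := fun i =>
    (Complex.ofRealCLM.contDiff.comp (hsm.mul (by fun_prop))).mul contDiff_const
  -- The witness is χ(ξ) ξ_i / (2πi ‖ξ‖²); where φ ≠ 0 the sum reduces to Σ ξ_i²/‖ξ‖² = 1.
  refine ⟨fun i => (hc i).toSchwartzMap (hd i), fun ξ => ?_⟩
  by_cases h : φ ξ = 0
  · simp [h]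
  have hξ : ξ ≠ 0 := by
    rintro rfl
    exact hφ.zero_notMem (subset_tsupport _ h)
  have hpi : (2 * Real.pi * Complex.I) ≠ 0 := Complex.two_pi_I_ne_zero
  have hn : (‖ξ‖ ^ 2 : ℝ) ≠ 0 := by simpa using hξ
  have : ∀ i : Fin n, (2 * Real.pi * Complex.I) * ((ξ i : ℝ) : ℂ) * (hc i).toSchwartzMap (hd i) ξ =
      (((‖ξ‖ ^ 2)⁻¹ * (ξ i) ^ 2 : ℝ) : ℂ) := fun i => by
    change _ * (((χ ξ * (‖ξ‖ ^ 2)⁻¹ * ξ i : ℝ) : ℂ) * (2 * Real.pi * Complex.I)⁻¹) = _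
    rw [hχ ξ h]
    push_cast
    field_simp
  simp only [this]
  rw [← Complex.ofReal_sum, ← Finset.mul_sum, ← EuclideanSpace.real_norm_sq_eq,
    inv_mul_cancel₀ hn, Complex.ofReal_one, mul_one]

/-- The reproducing identity: it lets a merely measurable representative of S_k u be replaced by a
convolution with pointwise bounds. -/
theorem LP_fourierMultiplier (hφ : IsLittlewoodPaley φ) {m : 𝓢(Space n, ℂ)}
    (hm : ∀ ξ, (φ ξ : ℂ) * m ξ = φ ξ) (k : ℤ) (u : TimeDist n) :
    (fun t => TemperedDistribution.fourierMultiplierCLM ℂ (fun ξ => m ((2 : ℝ) ^ (-k) • ξ))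
      (LP φ k u t)) = LP φ k u := by
  funext t
  rw [LP, TemperedDistribution.fourierMultiplierCLM_fourierMultiplierCLM_apply
    (hφ.hasTemperateGrowth k) (hasTemperateGrowth_dilate m (by positivity))]
  congr 2
  funext ξ
  exact hm _

theorem LP_partialDeriv (hφ : IsLittlewoodPaley φ) (k : ℤ) (i : Fin n) (u : TimeDist n) :
    LP φ k (partialDeriv i u) = partialDeriv i (LP φ k u) := by
  funext t
  simp only [LP, partialDeriv, TemperedDistribution.lineDeriv_eq_fourierMultiplierCLM, map_smul]
  rw [TemperedDistribution.fourierMultiplierCLM_fourierMultiplierCLM_apply (by fun_prop)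
    (hφ.hasTemperateGrowth k), TemperedDistribution.fourierMultiplierCLM_fourierMultiplierCLM_apply
    (hφ.hasTemperateGrowth k) (by fun_prop)]
  congr 3
  exact mul_comm _ _

theorem exists_measurable_isGivenBy {u : TimeDist n} {k : ℤ} (h : Xk k u < ⊤) :
    ∃ f, Measurable f ∧ IsGivenBy u f := by
  obtain ⟨f, hf⟩ := exists_isGivenBy_of_Xk_lt_top h
  exact ⟨_, hf.1.stronglyMeasurable_mk.measurable, hf.congr hf.1.ae_eq_mk⟩

theorem sum_sq_le_sq_sum {ι : Type*} (s : Finset ι) (a : ι → ℝ≥0∞) :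
    ∑ i ∈ s, a i ^ 2 ≤ (∑ i ∈ s, a i) ^ 2 := by
  rw [sq (∑ i ∈ s, a i), Finset.sum_mul]
  refine Finset.sum_le_sum fun i hi => ?_
  rw [sq]
  gcongr
  exact Finset.single_le_sum (f := a) (fun _ _ => zero_le) hi

theorem sq_sum_le_card_mul {ι : Type*} [Fintype ι] (a : ι → ℝ≥0∞) :
    (∑ i, a i) ^ 2 ≤ Fintype.card ι * ∑ i, a i ^ 2 := by
  simpa [tsum_fintype] using tsum_mul_sq_le (fun _ : ι => 1) a

/-- Bernstein's inequality: a frequency-localized function is controlled by its gradient. -/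
theorem exists_Xk_LP_le (hn : 1 ≤ n) (hφ : IsLittlewoodPaley φ) :
    ∃ C : ℝ≥0, ∀ (k : ℤ) (u : TimeDist n),
      Xk k (LP φ k u) ≤ C * (2 : ℝ≥0∞) ^ (-k) * XkGrad k (LP φ k u) := by
  obtain ⟨m, hm⟩ := hφ.exists_inverse_gradient
  choose C hC using fun i => exists_kernelConv_bound (m i)
  -- The added 1 gives c ≥ 1, so the constant is at most c², and c ≠ 0, which excludes 0 · ∞ when
  -- the right side is infinite.
  set c : ℝ≥0 := n * (∑ i, C i) * 8 + 1 with hc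
  refine ⟨4 * c, fun k u => ?_⟩
  set ρ : ℝ := (2 : ℝ) ^ (-k) with hρ
  have hρ0 : 0 < ρ := by positivity
  have hρe : ENNReal.ofReal ρ = (2 : ℝ≥0∞) ^ (-k) := by
    rw [hρ, ofReal_two_zpow, ENNReal.rpow_intCast]
  have hc1 : 1 ≤ c := le_add_self
  have hc0 : c ≠ 0 := (zero_lt_one.trans_le hc1).ne'
  rcases eq_or_ne (XkGrad k (LP φ k u)) ⊤ with htop | htop
  · rw [htop, ENNReal.mul_top]
    · exact le_top
    · rw [← hρe]
      refine mul_ne_zero (by simpa using hc0) ?_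
      simpa using hρ0
  have hXi : ∀ i, Xk k (partialDeriv i (LP φ k u)) < ⊤ := fun i =>
    lt_of_le_of_lt (Finset.single_le_sum (f := fun i => Xk k (partialDeriv i (LP φ k u)))
      (fun _ _ => zero_le) (Finset.mem_univ i)) (lt_top_iff_ne_top.2 htop)
  choose h hh hu using fun i => exists_measurable_isGivenBy (hXi i)
  have hM : ∀ i, MorreyBound ρ (fun p => ‖h i p‖ₑ ^ 2)
      (8 * Xk k (partialDeriv i (LP φ k u)) ^ 2) := fun i => by
    rw [Xk_eq (hu i) k]
    exact morreyBound_of_XkFun hn k (h i)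
  have hB : ∀ i, 8 * Xk k (partialDeriv i (LP φ k u)) ^ 2 ≠ ⊤ := fun i => by
    have := (hXi i).ne
    finiteness
  have hconv := fun i => hC i hρ0 (hB i) (hh i) (hu i) (hM i)
  -- The derivative has symbol 2πi ξ_i, whereas the dilated identity for m_i involves ρξ_i; the
  -- prefactor ρ supplies the difference, and it is the gain 2⁻ᵏ.
  have hrep : (fun t => ∑ i, (ρ : ℂ) • TemperedDistribution.fourierMultiplierCLM ℂ
      (fun ξ => m i (ρ • ξ)) (partialDeriv i (LP φ k u) t)) = LP φ k u := by
    funext t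
    have hgφ : (fun ξ => ((φ (ρ • ξ) : ℝ) : ℂ)).HasTemperateGrowth := hφ.hasTemperateGrowth k
    have hgm := fun i => hasTemperateGrowth_dilate (m i) hρ0
    have hg : ∀ i : Fin n, (fun ξ : Space n =>
        (((inner ℝ ξ (EuclideanSpace.single i (1 : ℝ)) : ℝ)) : ℂ)).HasTemperateGrowth :=
      fun i => by fun_prop
    have hfun : ∀ i : Fin n, (fun ξ => ((φ (ρ • ξ) : ℝ) : ℂ) *
        ((2 * Real.pi * Complex.I) * (((ρ • ξ) i : ℝ) : ℂ) * m i (ρ • ξ))) =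
        ((ρ : ℂ) * (2 * Real.pi * Complex.I)) • ((fun ξ => ((φ (ρ • ξ) : ℝ) : ℂ)) *
          (fun ξ : Space n => (((inner ℝ ξ (EuclideanSpace.single i (1 : ℝ)) : ℝ)) : ℂ)) *
          fun ξ => m i (ρ • ξ)) := by
      intro i
      funext ξ
      simp only [Pi.smul_apply, Pi.mul_apply, smul_eq_mul, EuclideanSpace.inner_single_right,
        PiLp.smul_apply, conj_trivial, one_mul, Complex.ofReal_mul]
      ring
    have h1 : ∀ i, (ρ : ℂ) • TemperedDistribution.fourierMultiplierCLM ℂ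
        (fun ξ => m i (ρ • ξ)) (partialDeriv i (LP φ k u) t) =
        TemperedDistribution.fourierMultiplierCLM ℂ (fun ξ => ((φ (ρ • ξ) : ℝ) : ℂ) *
          ((2 * Real.pi * Complex.I) * (((ρ • ξ) i : ℝ) : ℂ) * m i (ρ • ξ))) (u t) := by
      intro i
      simp only [partialDeriv, TemperedDistribution.lineDeriv_eq_fourierMultiplierCLM, map_smul, LP,
        ← hρ]
      rw [TemperedDistribution.fourierMultiplierCLM_fourierMultiplierCLM_apply hgφ (hg i),
        TemperedDistribution.fourierMultiplierCLM_fourierMultiplierCLM_apply (hgφ.mul (hg i))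
          (hgm i), smul_smul, hfun i,
        TemperedDistribution.fourierMultiplierCLM_smul ((hgφ.mul (hg i)).mul (hgm i))]
      rfl
    simp only [h1]
    rw [← sum_apply, ← TemperedDistribution.fourierMultiplierCLM_sum]
    · rw [LP]
      congr 2
      funext ξ
      rw [← Finset.mul_sum]
      exact hm _
    · intro i _
      rw [hfun i]
      exact (Function.HasTemperateGrowth.const _).mul ((hgφ.mul (hg i)).mul (hgm i))
  have hgiven : IsGivenBy (LP φ k u) fun p => ∑ i, (ρ : ℂ) * kernelConv (m i) ρ (h i) p := by
    rw [← hrep]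
    exact IsGivenBy.finset_sum fun i _ => (hconv i).1.const_smul _
  rw [Xk_eq hgiven]
  have hfin : MorreyBound ρ (fun p => ‖∑ i, (ρ : ℂ) * kernelConv (m i) ρ (h i) p‖ₑ ^ 2)
      ((c * ENNReal.ofReal ρ * XkGrad k (LP φ k u)) ^ 2) := by
    have h1 := (MorreyBound.finset_sum (s := Finset.univ) (fun i _ =>
      (Measurable.aemeasurable (by
        have := measurable_kernelConv (m i) ρ (hh i)
        fun_prop))) fun i _ => (hconv i).2.1).const_mul
      (c := n * ENNReal.ofReal ρ ^ 2) (by finiteness)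
    refine h1.mono (ae_of_all _ fun p => ?_) ?_
    · calc _ ≤ (∑ i, ‖(ρ : ℂ) * kernelConv (m i) ρ (h i) p‖ₑ) ^ 2 := by
            gcongr
            exact enorm_sum_le _ _
        _ ≤ _ := by
          refine (sq_sum_le_card_mul _).trans (le_of_eq ?_)
          have : ‖(ρ : ℂ)‖ₑ = ENNReal.ofReal ρ := by
            rw [← ofReal_norm, Complex.norm_real, Real.norm_of_nonneg hρ0.le]
          simp only [enorm_mul, mul_pow, this, Fintype.card_fin]
          rw [← Finset.mul_sum, mul_assoc]
    · calc _ ≤ n * ENNReal.ofReal ρ ^ 2 * ∑ i, (((∑ i, C i : ℝ≥0) : ℝ≥0∞) * 8) *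
            Xk k (partialDeriv i (LP φ k u)) ^ 2 := by
            gcongr _ * ?_
            refine Finset.sum_le_sum fun i _ => ?_
            rw [← mul_assoc]
            gcongr
            exact Finset.single_le_sum (f := C) (fun _ _ => zero_le) (Finset.mem_univ i)
        _ ≤ n * ENNReal.ofReal ρ ^ 2 * ((((∑ i, C i : ℝ≥0) : ℝ≥0∞) * 8) *
            XkGrad k (LP φ k u) ^ 2) := by
            rw [← Finset.mul_sum]
            gcongr
            exact sum_sq_le_sq_sum _ _
        _ = ((n * (∑ i, C i) * 8 : ℝ≥0) : ℝ≥0∞) * (ENNReal.ofReal ρ ^ 2 *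
            XkGrad k (LP φ k u) ^ 2) := by
            push_cast
            ring
        _ ≤ (c : ℝ≥0∞) ^ 2 * (ENNReal.ofReal ρ ^ 2 * XkGrad k (LP φ k u) ^ 2) := by
            gcongr
            have : n * (∑ i, C i) * 8 ≤ c ^ 2 :=
              le_trans le_self_add (le_self_pow₀ hc1 two_ne_zero)
            exact_mod_cast this
        _ = _ := by ring
  refine (XkFun_le_of_morreyBound k _ hfin).trans (le_of_eq ?_)
  rw [hρe]
  push_cast
  ring

/-! ### Summation of the Littlewood–Paley pieces and the weighted estimates -/

theorem hasSum_of_tsum_enorm_lt_top {f : ℤ → ℂ} (h : ∑' k, ‖f k‖ₑ < ⊤) :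
    HasSum f (∑' k, f k) ∧ Tendsto (fun K : ℕ => ∑ k ∈ Finset.Icc (-(K : ℤ)) K, f k) atTop
      (𝓝 (∑' k, f k)) := by
  have h1 : Summable fun k => ‖f k‖₊ := ENNReal.tsum_coe_ne_top_iff_summable.1 h.ne
  have h2 : Summable f := Summable.of_nnnorm h1
  exact ⟨h2.hasSum, h2.hasSum.comp Finset.tendsto_Icc_neg⟩

/-- The sum of the functions giving the Littlewood–Paley pieces gives the distribution. -/
theorem isGivenBy_tsum (hn : 1 ≤ n) {u : TimeDist n} (hu : IsSumOfLP φ u)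
    {f : ℤ → ℝ × Space n → ℂ} (hf : ∀ k, Measurable (f k))
    (hfu : ∀ k, IsGivenBy (LP φ k u) (f k)) {δ : ℝ} (hδ : 0 < δ)
    (hfin : ∫⁻ p, ENNReal.ofReal (‖p.2‖ ^ (-1 - 2 * δ)) * (∑' k, ‖f k p‖ₑ) ^ 2 ∂spaceTime n < ⊤) :
    IsGivenBy u fun p => ∑' k, f k p := by
  have hS : Measurable fun p : ℝ × Space n => ∑' k, ‖f k p‖ₑ :=
    Measurable.tsum fun k => (hf k).enorm
  have hw0 : ∀ᵐ x : Space n, ENNReal.ofReal (‖x‖ ^ (-1 - 2 * δ)) ≠ 0 := by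
    filter_upwards [ae_ne_zero hn] with x hx
    have : 0 < ‖x‖ := norm_pos_iff.2 hx
    rw [ne_eq, ENNReal.ofReal_eq_zero, not_le]
    positivity
  have hSlt : ∀ {w S : ℝ≥0∞}, w ≠ 0 → w * S ^ 2 < ⊤ → S < ⊤ := fun {w S} hw h => by
    by_contra hS
    rw [not_lt_top_iff.1 hS] at h
    simp [hw] at h
  have hmeas : Measurable fun p : ℝ × Space n =>
      ENNReal.ofReal (‖p.2‖ ^ (-1 - 2 * δ)) * (∑' k, ‖f k p‖ₑ) ^ 2 := by fun_prop
  refine ⟨?_, ?_⟩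
  · refine aestronglyMeasurable_of_tendsto_ae atTop
      (f := fun (K : ℕ) p => ∑ k ∈ Finset.Icc (-(K : ℤ)) K, f k p)
      (fun K => (Finset.measurable_fun_sum _ fun k _ => hf k).aestronglyMeasurable) ?_
    filter_upwards [ae_lt_top hmeas hfin.ne, ae_spaceTime_snd hw0] with p hp hp0
    exact (hasSum_of_tsum_enorm_lt_top (hSlt hp0 hp)).2
  rw [spaceTime, lintegral_prod _ hmeas.aemeasurable] at hfin
  filter_upwards [ae_lt_top hmeas.lintegral_prod_right' hfin.ne,
    ae_all_iff.2 fun k => (hfu k).2, hu] with t htfin hgiven hlim η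
  have hη : Measurable η := η.continuous.measurable
  have hSt : Measurable fun x : Space n => ∑' k, ‖f k (t, x)‖ₑ := hS.comp measurable_prodMk_left
  -- The inverse weight ‖x‖^(1+2δ) must be dominated by an integer power of 1 + ‖x‖.
  obtain ⟨N, hN⟩ := exists_nat_ge (1 + 2 * δ)
  have hint : ∫⁻ x, ‖η x‖ₑ * ∑' k, ‖f k (t, x)‖ₑ < ⊤ := by
    refine lintegral_schwartz_mul_lt_top N (c := 1) ENNReal.one_ne_top (by fun_prop) hSt ?_ htfin η
    filter_upwards [hw0, ae_ne_zero hn] with x hx hx0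
    refine ⟨hx, ENNReal.ofReal_ne_top, ?_⟩
    have hp : 0 < ‖x‖ := norm_pos_iff.2 hx0
    rw [one_mul, ← ENNReal.ofReal_inv_of_pos (by positivity), ← Real.rpow_neg hp.le,
      ← Real.rpow_natCast]
    refine ENNReal.ofReal_le_ofReal ?_
    calc ‖x‖ ^ (-(-1 - 2 * δ)) ≤ (1 + ‖x‖) ^ (-(-1 - 2 * δ)) := by
          gcongr
          · linarith
          · linarith
      _ ≤ (1 + ‖x‖) ^ (N : ℝ) := Real.rpow_le_rpow_of_exponent_le (by linarith) (by linarith)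
  have hfinite : ∀ᵐ x, ∑' k, ‖f k (t, x)‖ₑ < ⊤ := by
    filter_upwards [ae_lt_top (hmeas.comp measurable_prodMk_left) htfin.ne, hw0] with x hx hx0
    exact hSlt hx0 hx
  have hbound : Integrable (fun x => (‖η x‖ₑ * ∑' k, ‖f k (t, x)‖ₑ).toReal) :=
    integrable_toReal_of_lintegral_ne_top (hη.enorm.mul hSt).aemeasurable hint.ne
  have hle : ∀ᵐ x, ∀ (z : ℂ), ‖z‖ₑ ≤ ∑' k, ‖f k (t, x)‖ₑ →
      ‖η x * z‖ ≤ (‖η x‖ₑ * ∑' k, ‖f k (t, x)‖ₑ).toReal := by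
    filter_upwards [hfinite] with x hx z hz
    rw [← toReal_enorm, enorm_mul]
    exact ENNReal.toReal_mono (ENNReal.mul_ne_top enorm_ne_top hx.ne) (by gcongr)
  have hpart : ∀ (s : Finset ℤ) x, ‖∑ k ∈ s, f k (t, x)‖ₑ ≤ ∑' k, ‖f k (t, x)‖ₑ := fun s x =>
    (enorm_sum_le _ _).trans (ENNReal.sum_le_tsum s)
  have hconv : ∀ᵐ x, Tendsto (fun K : ℕ => ∑ k ∈ Finset.Icc (-(K : ℤ)) K, f k (t, x)) atTop
      (𝓝 (∑' k, f k (t, x))) := by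
    filter_upwards [hfinite] with x hx
    exact (hasSum_of_tsum_enorm_lt_top hx).2
  have hpm : ∀ s : Finset ℤ, AEStronglyMeasurable (fun x => η x * ∑ k ∈ s, f k (t, x)) volume :=
    fun s => (hη.mul (Finset.measurable_fun_sum _ fun k _ =>
      (hf k).comp measurable_prodMk_left)).aestronglyMeasurable
  have hlimη : ∀ᵐ x, Tendsto (fun K : ℕ => η x * ∑ k ∈ Finset.Icc (-(K : ℤ)) K, f k (t, x)) atTop
      (𝓝 (η x * ∑' k, f k (t, x))) := by
    filter_upwards [hconv] with x hx
    exact hx.const_mul _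
  refine ⟨?_, ?_⟩
  · refine hbound.mono' (aestronglyMeasurable_of_tendsto_ae atTop (fun K => hpm _) hlimη) ?_
    filter_upwards [hle, hconv] with x hx hxc
    refine hx _ (le_of_tendsto hxc.enorm (Eventually.of_forall fun K => hpart _ x))
  -- The pairings of the partial sums converge to the integral against the series, and also to u t η
  -- because u is realized; the limits agree.
  · have h1 := tendsto_integral_of_dominated_convergence _ (fun K => hpm _) hbound
      (fun K : ℕ => by
        filter_upwards [hle] with x hx
        exact hx _ (hpart (Finset.Icc (-(K : ℤ)) K) x)) hlimη
    have h2 := (PointwiseConvergenceCLM.tendsto_iff_forall_tendsto.1 hlim) η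
    refine tendsto_nhds_unique h2 (h1.congr fun K => ?_)
    rw [sum_apply]
    simp only [Finset.mul_sum]
    rw [integral_finsetSum _ fun k _ => (hgiven k η).1]
    exact Finset.sum_congr rfl fun k _ => (hgiven k η).2.symm

theorem XNorm_sq (s : ℝ) (u : TimeDist n) :
    XNorm φ s u ^ 2 = ∑' k : ℤ, (2 : ℝ≥0∞) ^ (2 * (k : ℝ) * s) * Xk k (LP φ k u) ^ 2 := by
  rw [XNorm, ← ENNReal.rpow_natCast, ← ENNReal.rpow_mul]
  norm_num

theorem Xk_LP_lt_top {s : ℝ} {u : TimeDist n} (h : XNorm φ s u ≠ ⊤) (k : ℤ) :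
    Xk k (LP φ k u) < ⊤ := by
  have h1 : XNorm φ s u ^ 2 ≠ ⊤ := ENNReal.pow_ne_top h
  rw [XNorm_sq] at h1
  by_contra htop
  have := ENNReal.ne_top_of_tsum_ne_top h1 k
  rw [not_lt_top_iff.1 htop] at this
  simp at this

/-- The Hardy-type estimate of a distribution by its `X^δ` norm. -/
theorem exists_weightedL2_le (hφ : IsLittlewoodPaley φ) {δ : ℝ} (hδ : 0 < δ)
    (hδn : δ < ((n : ℝ) - 1) / 2) : ∃ C : ℝ≥0, ∀ u : TimeDist n, IsSumOfLP φ u →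
      weightedL2 (-(1 / 2) - δ) u ≤ C * XNorm φ δ u := by
  have hn : 1 ≤ n := by
    by_contra! h
    have : n = 0 := by omega
    subst this
    norm_num at hδn
    linarith
  obtain ⟨m, hm⟩ := hφ.exists_symbol_mul_eq
  obtain ⟨C₁, hC₁⟩ := exists_kernelConv_bound m
  -- Half of each available gap: this ensures ε < 2δ and 1 + 2δ + ε < n.
  set ε : ℝ := min δ (((n : ℝ) - 1 - 2 * δ) / 2) with hε
  have hε0 : 0 < ε := lt_min hδ (by linarith)
  have hεδ : ε ≤ δ := min_le_left _ _
  have hεn : ε ≤ ((n : ℝ) - 1 - 2 * δ) / 2 := min_le_right _ _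
  obtain ⟨C₂, hC₂⟩ := exists_weighted_bound (n := n) hn hε0 (δ := δ) (by linarith) (by linarith)
  obtain ⟨C₃, hC₃⟩ := exists_lintegral_tsum_sq_le (n := n) hn hε0
  set C : ℝ≥0 := C₃ * C₂ * C₁ * 8 + 1 with hC
  have hC1 : 1 ≤ C := le_add_self
  refine ⟨C, fun u hu => ?_⟩
  rcases eq_or_ne (XNorm φ δ u) ⊤ with htop | htop
  · rw [htop, ENNReal.mul_top]
    · exact le_top
    · exact_mod_cast (zero_lt_one.trans_le hC1).ne'
  choose h hh hhu using fun k => exists_measurable_isGivenBy (Xk_LP_lt_top htop k)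
  -- These still represent S_k u, by the reproducing identity, but are now controlled pointwise near
  -- the origin.
  set f : ℤ → ℝ × Space n → ℂ := fun k => kernelConv m ((2 : ℝ) ^ (-k)) (h k) with hf
  have hfm : ∀ k, Measurable (f k) := fun k => measurable_kernelConv m _ (hh k)
  have hB : ∀ k, 8 * Xk k (LP φ k u) ^ 2 ≠ ⊤ := fun k => by
    have := (Xk_LP_lt_top htop k).ne
    finiteness
  have hM : ∀ k, MorreyBound ((2 : ℝ) ^ (-k)) (fun p => ‖h k p‖ₑ ^ 2)
      (8 * Xk k (LP φ k u) ^ 2) := fun k => by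
    rw [Xk_eq (hhu k) k]
    exact morreyBound_of_XkFun hn k (h k)
  have hconv := fun k : ℤ => hC₁ (show (0 : ℝ) < 2 ^ (-k) by positivity) (hB k) (hh k) (hhu k) (hM k)
  have hfu : ∀ k, IsGivenBy (LP φ k u) (f k) := fun k => by
    have := (hconv k).1
    rwa [LP_fourierMultiplier hφ hm] at this
  have hsingle : ∀ k : ℤ, ∫⁻ p, ENNReal.ofReal (‖p.2‖ ^ (-1 - 2 * δ)) * (ENNReal.ofReal
      (max (2 ^ k * ‖p.2‖) (2 ^ k * ‖p.2‖)⁻¹ ^ ε) * ‖f k p‖ₑ ^ 2) ∂spaceTime n ≤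
      C₂ * C₁ * 8 * ((2 : ℝ≥0∞) ^ (2 * (k : ℝ) * δ) * Xk k (LP φ k u) ^ 2) := by
    intro k
    obtain ⟨-, hMk, N, hN, hfN, hNB⟩ := hconv k
    have h1 := hC₂ (show (0 : ℝ) < 2 ^ (-k) by positivity) (hfm k) hN hMk hfN
      (hNB.trans (le_of_eq (by ring)))
    have h2 : ∀ r : ℝ, r / (2 : ℝ) ^ (-k) = 2 ^ k * r := fun r => by
      rw [zpow_neg, div_inv_eq_mul, mul_comm]
    have h3 : ENNReal.ofReal (((2 : ℝ) ^ (-k)) ^ (-2 * δ)) = (2 : ℝ≥0∞) ^ (2 * (k : ℝ) * δ) := by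
      rw [← ENNReal.ofReal_rpow_of_pos (by positivity), ofReal_two_zpow, ← ENNReal.rpow_mul]
      congr 1
      push_cast
      ring
    simp only [h2, h3] at h1
    exact h1.trans (le_of_eq (by ring))
  have hsum : ∫⁻ p, ENNReal.ofReal (‖p.2‖ ^ (-1 - 2 * δ)) * (∑' k, ‖f k p‖ₑ) ^ 2 ∂spaceTime n ≤
      (C * XNorm φ δ u) ^ 2 := by
    calc _ ≤ _ := hC₃ hfm (w := fun x => ENNReal.ofReal (‖x‖ ^ (-1 - 2 * δ))) (by fun_prop)
      _ ≤ C₃ * ∑' k : ℤ, C₂ * C₁ * 8 * ((2 : ℝ≥0∞) ^ (2 * (k : ℝ) * δ) * Xk k (LP φ k u) ^ 2) := by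
        gcongr with k
        exact hsingle k
      _ = ((C₃ * C₂ * C₁ * 8 : ℝ≥0) : ℝ≥0∞) * XNorm φ δ u ^ 2 := by
        rw [ENNReal.tsum_mul_left, XNorm_sq]
        push_cast
        ring
      _ ≤ (C : ℝ≥0∞) ^ 2 * XNorm φ δ u ^ 2 := by
        gcongr
        have : C₃ * C₂ * C₁ * 8 ≤ C ^ 2 := le_trans le_self_add (le_self_pow₀ hC1 two_ne_zero)
        exact_mod_cast this
      _ = _ := by ring
  have hF := isGivenBy_tsum hn hu hfm hfu hδ (hsum.trans_lt (by finiteness))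
  refine (iInf₂_le _ hF).trans ?_
  rw [← ENNReal.pow_le_pow_left_iff two_ne_zero, weightedL2On_sq, Measure.restrict_univ]
  refine le_trans (lintegral_mono fun p => ?_) hsum
  rw [show 2 * (-(1 / 2) - δ) = -1 - 2 * δ by ring]
  gcongr
  exact enorm_tsum_le_tsum_enorm

/-- The `X^s` norm is controlled by the `X^{s-1}` norm of the gradient. -/
theorem exists_XNorm_le_XNormGrad (hn : 1 ≤ n) (hφ : IsLittlewoodPaley φ) (s : ℝ) :
    ∃ C : ℝ≥0, ∀ u : TimeDist n, XNorm φ s u ≤ C * XNormGrad φ (s - 1) u := by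
  obtain ⟨C, hC⟩ := exists_Xk_LP_le hn hφ
  refine ⟨C * n, fun u => ?_⟩
  rw [← ENNReal.pow_le_pow_left_iff two_ne_zero, XNorm_sq]
  have hX : ∀ k, Xk k (LP φ k u) ≤
      C * (2 : ℝ≥0∞) ^ (-k) * ∑ i, Xk k (LP φ k (partialDeriv i u)) := fun k => by
    have := hC k u
    rw [XkGrad] at this
    simpa only [LP_partialDeriv hφ] using this
  have h2 : ∀ k : ℤ, (2 : ℝ≥0∞) ^ (2 * (k : ℝ) * s) * ((2 : ℝ≥0∞) ^ (-k)) ^ 2 =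
      (2 : ℝ≥0∞) ^ (2 * (k : ℝ) * (s - 1)) := fun k => by
    rw [← ENNReal.rpow_intCast, ← ENNReal.rpow_natCast, ← ENNReal.rpow_mul,
      ← ENNReal.rpow_add _ _ (by norm_num) (by norm_num)]
    congr 1
    push_cast
    ring
  calc _ ≤ ∑' k : ℤ, (2 : ℝ≥0∞) ^ (2 * (k : ℝ) * s) * (C * (2 : ℝ≥0∞) ^ (-k) *
        ∑ i, Xk k (LP φ k (partialDeriv i u))) ^ 2 := by
        gcongr with k
        exact hX k
    _ ≤ ∑' k : ℤ, (C : ℝ≥0∞) ^ 2 * n * ∑ i, (2 : ℝ≥0∞) ^ (2 * (k : ℝ) * (s - 1)) *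
        Xk k (LP φ k (partialDeriv i u)) ^ 2 := by
        refine ENNReal.tsum_le_tsum fun k => ?_
        rw [← Finset.mul_sum, ← h2]
        calc _ = (C : ℝ≥0∞) ^ 2 * ((2 : ℝ≥0∞) ^ (2 * (k : ℝ) * s) * ((2 : ℝ≥0∞) ^ (-k)) ^ 2) *
              (∑ i, Xk k (LP φ k (partialDeriv i u))) ^ 2 := by ring
          _ ≤ (C : ℝ≥0∞) ^ 2 * ((2 : ℝ≥0∞) ^ (2 * (k : ℝ) * s) * ((2 : ℝ≥0∞) ^ (-k)) ^ 2) *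
              (n * ∑ i, Xk k (LP φ k (partialDeriv i u)) ^ 2) := by
            gcongr
            simpa using sq_sum_le_card_mul fun i => Xk k (LP φ k (partialDeriv i u))
          _ = _ := by ring
    _ = (C : ℝ≥0∞) ^ 2 * n * ∑ i, XNorm φ (s - 1) (partialDeriv i u) ^ 2 := by
        rw [ENNReal.tsum_mul_left, Summable.tsum_finsetSum fun _ _ => ENNReal.summable]
        simp only [XNorm_sq]
    _ ≤ (C : ℝ≥0∞) ^ 2 * (n : ℝ≥0∞) ^ 2 * XNormGrad φ (s - 1) u ^ 2 := by
        gcongr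
        · have : n ≤ n ^ 2 := Nat.le_self_pow two_ne_zero n
          exact_mod_cast this
        · exact sum_sq_le_sq_sum _ _
    _ = _ := by
        push_cast
        ring

/-- The weighted Cauchy–Schwarz inequality for the space-time pairing. -/
theorem absPairing_le (hn : 1 ≤ n) (a : ℝ) {g f : ℝ × Space n → ℂ}
    (hg : AEStronglyMeasurable g (spaceTime n)) (hf : AEStronglyMeasurable f (spaceTime n))
    (hgt : weightedL2On a univ g ≠ ⊤) (hft : weightedL2On (-a) univ f ≠ ⊤) :
    absPairing g f ≤ weightedL2On a univ g * weightedL2On (-a) univ f := by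
  have h1 : ∫⁻ p, ‖g p * f p‖ₑ ∂spaceTime n ≤
      weightedL2On a univ g * weightedL2On (-a) univ f := by
    rw [← ENNReal.pow_le_pow_left_iff two_ne_zero, mul_pow, weightedL2On_sq, weightedL2On_sq,
      Measure.restrict_univ]
    have hsq : ∀ (b : ℝ) (p : ℝ × Space n), ENNReal.ofReal (‖p.2‖ ^ (2 * b)) =
        ENNReal.ofReal (‖p.2‖ ^ b) ^ 2 := fun b p => by
      rw [← ENNReal.ofReal_pow (by positivity), ← Real.rpow_mul_natCast (norm_nonneg _)]
      congr 2
      push_cast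
      ring
    simp only [hsq, ← mul_pow]
    refine le_trans (le_of_eq ?_) (lintegral_mul_sq_le (AEMeasurable.mul (by
      exact Measurable.aemeasurable (by fun_prop)) hg.enorm) (AEMeasurable.mul (by
      exact Measurable.aemeasurable (by fun_prop)) hf.enorm))
    congr 1
    refine lintegral_congr_ae ?_
    filter_upwards [ae_spaceTime_snd (ae_ne_zero hn)] with p hp
    have hp0 : 0 < ‖p.2‖ := norm_pos_iff.2 hp
    have h2 : ENNReal.ofReal (‖p.2‖ ^ a) * ENNReal.ofReal (‖p.2‖ ^ (-a)) = 1 := by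
      rw [← ENNReal.ofReal_mul (by positivity), ← Real.rpow_add hp0]
      simp
    rw [enorm_mul, mul_mul_mul_comm, h2, one_mul]
  have hint : Integrable (fun p => g p * f p) (spaceTime n) :=
    ⟨hg.mul hf, h1.trans_lt (ENNReal.mul_lt_top hgt.lt_top hft.lt_top)⟩
  rw [absPairing, if_pos hint]
  exact (enorm_integral_le_lintegral_enorm _).trans h1

/-- The dual norm is controlled by a weighted `L²` norm. -/
theorem dualNorm_le (hn : 1 ≤ n) {δ : ℝ} {C : ℝ≥0} (hC : ∀ u : TimeDist n, IsSumOfLP φ u →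
      weightedL2 (-(1 / 2) - δ) u ≤ C * XNorm φ δ u) {g : ℝ × Space n → ℂ}
    (hg : AEStronglyMeasurable g (spaceTime n)) :
    dualNorm φ δ g ≤ ((C + 1 : ℝ≥0) : ℝ≥0∞) * weightedL2On (1 / 2 + δ) univ g := by
  refine iSup₂_le fun v hv => ?_
  rcases eq_or_ne (weightedL2On (1 / 2 + δ) univ g) ⊤ with htop | htop
  · rw [htop, ENNReal.mul_top (by simp)]
    exact le_top
  -- The strict inequality, gained by C + 1, lets a representative be chosen without assuming that
  -- the infimum is attained.
  have h1 : weightedL2 (-(1 / 2) - δ) v < ((C + 1 : ℝ≥0) : ℝ≥0∞) := by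
    refine ((hC v hv.1).trans (mul_le_of_le_one_right zero_le hv.2)).trans_lt ?_
    exact_mod_cast lt_add_one C
  obtain ⟨f, hf⟩ := iInf_lt_iff.1 h1
  obtain ⟨hfv, hfC⟩ := iInf_lt_iff.1 hf
  rw [show -(1 / 2) - δ = -(1 / 2 + δ) by ring] at hfC
  refine (iInf₂_le f hfv).trans ?_
  refine (absPairing_le hn (1 / 2 + δ) hg hfv.1 htop (hfC.trans ENNReal.coe_lt_top).ne).trans ?_
  rw [mul_comm]
  gcongr

end

end LocalizedEnergy

end

theorem lemma4p3 (n : ℕ) (hn : 2 ≤ n) (φ : LocalizedEnergy.Space n → ℝ)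
    (hφ : LocalizedEnergy.IsLittlewoodPaley φ) :
    (∀ δ : ℝ, 0 < δ → δ < ((n : ℝ) - 1) / 2 → ∃ C : ℝ≥0,
      (∀ u : LocalizedEnergy.TimeDist n, LocalizedEnergy.IsSumOfLP φ u →
        LocalizedEnergy.weightedL2 (-(1 / 2) - δ) u ≤ C * LocalizedEnergy.XNorm φ δ u) ∧
      (∀ u : LocalizedEnergy.TimeDist n, LocalizedEnergy.IsSumOfLP φ u →
        LocalizedEnergy.weightedL2 (-(1 / 2) - δ) u ≤
          C * LocalizedEnergy.XNormGrad φ (δ - 1) u) ∧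
      (∀ g : ℝ × LocalizedEnergy.Space n → ℂ,
        AEStronglyMeasurable g (LocalizedEnergy.spaceTime n) →
        LocalizedEnergy.dualNorm φ δ g ≤ C * LocalizedEnergy.weightedL2On (1 / 2 + δ) univ g)) ∧
    ∃ C : ℝ≥0, ∀ (k : ℤ) (u : LocalizedEnergy.TimeDist n),
      LocalizedEnergy.Xk k (LocalizedEnergy.LP φ k u) ≤
        C * (2 : ℝ≥0∞) ^ (-k) * LocalizedEnergy.XkGrad k (LocalizedEnergy.LP φ k u) := by
  have hn1 : 1 ≤ n := by omega
  refine ⟨fun δ hδ hδn => ?_, LocalizedEnergy.exists_Xk_LP_le hn1 hφ⟩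
  obtain ⟨C, hC⟩ := LocalizedEnergy.exists_weightedL2_le hφ hδ hδn
  obtain ⟨D, hD⟩ := LocalizedEnergy.exists_XNorm_le_XNormGrad hn1 hφ δ
  refine ⟨max (C + 1) (C * D), fun u hu => ?_, fun u hu => ?_, fun g hg => ?_⟩
  · refine (hC u hu).trans ?_
    gcongr
    exact le_max_of_le_left le_self_add
  · refine (hC u hu).trans ?_
    calc (C : ℝ≥0∞) * LocalizedEnergy.XNorm φ δ u
        ≤ C * (D * LocalizedEnergy.XNormGrad φ (δ - 1) u) := by
          gcongr
          exact hD u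
      _ = ((C * D : ℝ≥0) : ℝ≥0∞) * LocalizedEnergy.XNormGrad φ (δ - 1) u := by
          push_cast
          ring
      _ ≤ _ := by
          gcongr
          exact le_max_right _ _
  · refine (LocalizedEnergy.dualNorm_le hn1 hC hg).trans ?_
    gcongr
    exact le_max_left _ _
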